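/- Let $\mathbb T=\mathbb R/\mathbb Z$, and let $\mathbb T^2$ carry the Lebesgue measure of total mass $1$. For $f\in L^1(\mathbb T^2)$ write $\widehat f(m,k)=\int_{\mathbb T^2} f(x,t)\,e^{-2\pi i(mx+kt)}\,dx\,dt$. For a real number $p\ge 2$ with $p'=p/(p-1)$, and an integer $N\ge 1$, let $A_{p,N}$ be the smallest constant such that $$\sum_{n=-N}^{N}\bigl|\widehat f(n,n^3)\bigr|^2\le A_{p,N}\,\|f\|_{L^{p'}(\mathbb T^2)}^2\qquad\text{for all } f\in L^{p'}(\mathbb T^2),$$ and let $K_{p,N}$ be the smallest constant such that $$\Bigl\|\sum_{n=-N}^{N}a_n e^{2\pi i tn^3+2\pi i xn}\Bigr\|_{L^p_{x,t}(\mathbb T^2)}\le K_{p,N}\Bigl(\sum_{n=-N}^{N}|a_n|^2\Bigr)^{1/2}\qquad\text{for all complex } a_{-N},\dots,a_N.$$ **Theorem.** Let $p\ge 14$ be real and let $\varepsilon>0$. There is a constant $C=C_{p,\varepsilon}>0$, independent of $N$, such that for all integers $N\ge 1$ $$A_{p,N}\le C\,N^{1-\frac 8p+\varepsilon}.$$ Likewise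 (this is the same estimate in dual form), there is a constant $C'=C'_{p,\varepsilon}>0$, independent of $N$, such that for all integers $N\ge 1$ $$K_{p,N}\le C'\,N^{\frac12-\frac4p+\varepsilon}.$$ -/

import Mathlib

open MeasureTheory
open scoped ENNReal

noncomputable section

namespace CubicRestriction

/-- The torus `𝕋² = (ℝ/ℤ)²` with coordinates `(x, t) = (z 0, z 1)`. -/
abbrev Torus2 : Type := UnitAddTorus (Fin 2)

/-- The normalised Haar (Lebesgue) measure on `𝕋²`, of total mass `1`. This is the measure with
respect to which `UnitAddTorus.mFourierCoeff` integrates. -/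
def torusMeasure : Measure Torus2 :=
  Measure.pi fun _ : Fin 2 => (AddCircle.haarAddCircle : Measure UnitAddCircle)

/-- The frequency `(n, n³)`. -/
def cubicFreq (n : ℤ) : Fin 2 → ℤ := ![n, n ^ 3]

/-- The best (smallest) constant `A` in
`∑_{|n| ≤ N} |f̂(n, n³)|² ≤ A ‖f‖_{p'}²` over all `f ∈ L^{p'}(𝕋²)`, where `p' = p / (p - 1)`.
It is `[0, ∞]`-valued, so that it would be `∞` if no finite constant were admissible. -/
def restrictionConst (p : ℝ) (N : ℕ) : ℝ≥0∞ :=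
  sInf {A : ℝ≥0∞ | ∀ f : Torus2 → ℂ, MemLp f (ENNReal.ofReal (p / (p - 1))) torusMeasure →
    ∑ n ∈ Finset.Icc (-(N : ℤ)) (N : ℤ), ‖UnitAddTorus.mFourierCoeff f (cubicFreq n)‖ₑ ^ 2 ≤
      A * eLpNorm f (ENNReal.ofReal (p / (p - 1))) torusMeasure ^ 2}

/-- The exponential sum `∑_{|n| ≤ N} a_n e^{2πi t n³ + 2πi x n}` as a function on `𝕋²`. -/
def cubicSum (N : ℕ) (a : ℤ → ℂ) (z : Torus2) : ℂ :=
  ∑ n ∈ Finset.Icc (-(N : ℤ)) (N : ℤ), a n * UnitAddTorus.mFourier (cubicFreq n) z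

/-- The best (smallest) constant `K` in
`‖∑_{|n| ≤ N} a_n e^{2πi t n³ + 2πi x n}‖_{L^p(𝕋²)} ≤ K (∑_{|n| ≤ N} |a_n|²)^{1/2}`
over all complex coefficients `a`, with values in `[0, ∞]`. -/
def strichartzConst (p : ℝ) (N : ℕ) : ℝ≥0∞ :=
  sInf {K : ℝ≥0∞ | ∀ a : ℤ → ℂ,
    eLpNorm (cubicSum N a) (ENNReal.ofReal p) torusMeasure ≤
      K * (∑ n ∈ Finset.Icc (-(N : ℤ)) (N : ℤ), ‖a n‖ₑ ^ 2) ^ (1 / 2 : ℝ)}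

end CubicRestriction

end

/-! Let F be an exponential sum over the frequencies (n, n³), |n| ≤ N, with coefficients of ℓ² norm
at most 1. The restriction estimate follows from the bound on ‖F‖_p by duality
(`sum_enorm_mFourierCoeff_sq_le`). Since |F| ≤ 2√N, every p ≥ 14 reduces to p = 14, where ∫|F|¹⁴ ≲
N^(3+ε) is needed. Two estimates meet at the height |F| ~ N^(3/8).

Below that height, ∫|F|⁶ ≲ N^ε (`exists_integral_norm_cubicSum_pow_six_le`) suffices, because |F|¹⁴
≤ r⁸|F|⁶ where |F| ≤ r. The sixth moment counts solutions of a system in three plus three variables;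
the identity (a+b+c)³ − a³ − b³ − c³ = 3(a+b)(b+c)(a+c) reduces that count to the divisor bound.

Above it, |{|F| > r}| ≲ N^(1+ε) r⁻¹⁰ (`exists_levelMeasure_le`). A dyadic layer then contributes
about N r⁴ to the 14th moment, which is N³ at the top r ~ √N.

The level set bound comes from a localised kernel. Multiply ∑ e(nx + n³t) by the indicator Φ(t) of
short arcs around the fractions a/q with q prime in (Q, 4Q] and Q ≥ 24N². On these arcs Weyl's
inequality bounds the kernel by (NQ)^(1/4), up to Q^ε. On the curve its Fourier coefficients equal
the mean of Φ, which is at least a constant over log Q; off the curve they vanish or are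
coefficients of Φ at nonzero frequencies, hence O(1/Q), because a nonzero integer that is not huge
has few prime factors in (Q, 4Q]. Pairing f with its convolution against this kernel gives
∑|f̂(n,n³)|² ≲ Q^ε((NQ)^(1/4)‖f‖₁² + Q⁻¹‖f‖₂²) (`exists_restriction_bound`). Apply this to the phase
of F on a level set with Q close to r⁸/N, so that the first term is absorbed. The requirement Q ≳ N²
is then r ≳ N^(3/8), the height at which the sixth moment takes over. -/

noncomputable section

namespace CubicRestriction

/-! ### Divisors and primes. -/

/-- The divisor bound. -/
theorem exists_card_divisors_le (ε : ℝ) (hε : 0 < ε) :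
    ∃ C : ℝ, 1 ≤ C ∧ ∀ n : ℕ, n ≠ 0 → (n.divisors.card : ℝ) ≤ C * (n : ℝ) ^ ε := by
  -- Primes p ≥ M, with `M` defined below, satisfy p^ε ≥ 2, so a + 1 ≤ 2^a ≤ p^(aε) at no cost. Each
  -- of the fewer than M smaller primes costs one factor K, and Kε log 2 ≥ 1 makes a + 1 ≤ K·2^(aε).
  set K : ℝ := max 1 (1 / (ε * Real.log 2)) with hK
  have hlog : 0 < Real.log 2 := Real.log_pos (by norm_num)
  have hK1 : 1 ≤ K := le_max_left _ _
  have hK2 : 1 ≤ K * (ε * Real.log 2) := by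
    have : 1 / (ε * Real.log 2) ≤ K := le_max_right _ _
    rwa [div_le_iff₀ (by positivity)] at this
  set M : ℕ := ⌈(2 : ℝ) ^ (1 / ε)⌉₊ with hM
  have key : ∀ p : ℕ, p.Prime → ∀ a : ℕ,
      ((a : ℝ) + 1) ≤ (if p < M then K else 1) * ((p : ℝ) ^ a) ^ ε := by
    intro p hp a
    have hp2 : (2 : ℝ) ≤ p := by exact_mod_cast hp.two_le
    have hpow : ((p : ℝ) ^ a) ^ ε = ((p : ℝ) ^ ε) ^ a := by
      rw [← Real.rpow_natCast, ← Real.rpow_mul (by positivity), mul_comm,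
        Real.rpow_mul (by positivity), Real.rpow_natCast]
    split_ifs with h
    · have h1 : ((2 : ℝ) ^ a) ^ ε ≤ ((p : ℝ) ^ a) ^ ε := by gcongr
      have h2 : 1 + a * (ε * Real.log 2) ≤ ((2 : ℝ) ^ a) ^ ε := by
        rw [← Real.rpow_natCast, ← Real.rpow_mul (by positivity), Real.rpow_def_of_pos (by norm_num)]
        have := Real.add_one_le_exp (Real.log 2 * (a * ε))
        linarith
      calc (a : ℝ) + 1 ≤ K * (1 + a * (ε * Real.log 2)) := by
            nlinarith [mul_le_mul_of_nonneg_left hK2 (Nat.cast_nonneg (α := ℝ) a)]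
        _ ≤ _ := by gcongr; exact h2.trans h1
    · have hMp : (2 : ℝ) ^ (1 / ε) ≤ p := (Nat.le_ceil _).trans (by exact_mod_cast not_lt.mp h)
      have h2 : (2 : ℝ) ≤ (p : ℝ) ^ ε := by
        calc (2 : ℝ) = ((2 : ℝ) ^ (1 / ε)) ^ ε := by
              rw [← Real.rpow_mul (by norm_num), one_div_mul_cancel hε.ne', Real.rpow_one]
          _ ≤ _ := by gcongr
      rw [one_mul, hpow]
      calc (a : ℝ) + 1 ≤ 2 ^ a := by exact_mod_cast Nat.lt_two_pow_self
        _ ≤ _ := by gcongr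
  refine ⟨K ^ M, one_le_pow₀ hK1, fun n hn => ?_⟩
  rw [Nat.card_divisors hn]
  push_cast
  have hn' : (n : ℝ) ^ ε = ∏ p ∈ n.primeFactors, ((p : ℝ) ^ (n.factorization p)) ^ ε := by
    conv_lhs => rw [← Nat.prod_factorization_pow_eq_self hn]
    rw [Finsupp.prod, Nat.support_factorization]
    push_cast
    rw [← Real.finsetProd_rpow]
    intros; positivity
  calc ∏ p ∈ n.primeFactors, ((n.factorization p : ℝ) + 1)
      ≤ ∏ p ∈ n.primeFactors, ((if p < M then K else 1) * ((p : ℝ) ^ (n.factorization p)) ^ ε) :=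
        Finset.prod_le_prod (fun _ _ => by positivity)
          (fun p hp => key p (Nat.prime_of_mem_primeFactors hp) _)
    _ = (∏ p ∈ n.primeFactors, (if p < M then K else 1)) * (n : ℝ) ^ ε := by
        rw [Finset.prod_mul_distrib, hn']
    _ ≤ K ^ M * (n : ℝ) ^ ε := by
        gcongr
        rw [Finset.prod_ite, Finset.prod_const, Finset.prod_const_one, mul_one]
        refine pow_le_pow_right₀ hK1 ?_
        calc _ ≤ (Finset.range M).card := Finset.card_le_card (by
              intro p; simp)
          _ = M := Finset.card_range M

/-- The primes in the interval `(Q, 4Q]`. -/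
def primesBetween (Q : ℕ) : Finset ℕ := (Finset.Ioc Q (4 * Q)).filter Nat.Prime

/-- Chebyshev's lower bound for the number of primes in `(Q, 4Q]`. -/
theorem exists_le_card_primesBetween :
    ∃ Q₀ : ℕ, 1 ≤ Q₀ ∧ ∀ Q : ℕ, Q₀ ≤ Q →
      (Q : ℝ) ≤ (primesBetween Q).card * Real.log (4 * Q) := by
  -- The main term of θ(4Q) − θ(Q) is 4Q log 2 − Q log 4 = 2Q log 2 > 1.38 Q, so an error of Q/4 is
  -- affordable. With (Q, 2Q] in place of (Q, 4Q] these bounds would cancel to nothing.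
  have h1 : ∀ᶠ x : ℝ in Filter.atTop, Real.log (4 * x + 1) + 2 * √(4 * x) * Real.log (4 * x)
      ≤ (1 / 4) * x := by
    have a1 : (fun x : ℝ => Real.log x) =o[Filter.atTop] fun x => x ^ (1 / 4 : ℝ) :=
      isLittleO_log_rpow_atTop (by norm_num)
    have := a1.bound (c := 1 / 100) (by norm_num)
    filter_upwards [(Filter.tendsto_id.const_mul_atTop (by norm_num : (0:ℝ) < 5)).eventually this,
      Filter.eventually_ge_atTop 100000] with x hx hx1
    have hx0 : 0 < x := by linarith
    simp only [id] at hx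
    rw [Real.norm_of_nonneg (Real.log_nonneg (by linarith)), Real.norm_of_nonneg (by positivity)] at hx
    have e1 : Real.log (4 * x + 1) ≤ Real.log (5 * x) := Real.log_le_log (by linarith) (by linarith)
    have e2 : Real.log (4 * x) ≤ Real.log (5 * x) := Real.log_le_log (by linarith) (by linarith)
    set y := (5 * x) ^ (1 / 4 : ℝ) with hy
    have hy4 : y ^ 4 = 5 * x := by
      rw [hy, ← Real.rpow_natCast, ← Real.rpow_mul (by positivity)]; norm_num
    have hy0 : 0 ≤ y := by positivity
    have hy1 : 1 ≤ y := Real.one_le_rpow (by linarith) (by norm_num)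
    have hs : √(4 * x) ≤ y ^ 2 := by
      apply Real.sqrt_le_iff.mpr ⟨by positivity, by nlinarith⟩
    have e3 : 0 ≤ Real.log (4 * x) := Real.log_nonneg (by linarith)
    have : 2 * √(4 * x) * Real.log (4 * x) ≤ 2 * y ^ 2 * (1 / 100 * y) := by
      gcongr; linarith
    have h3 : y ≤ y ^ 3 := by nlinarith [mul_nonneg hy0 hy0]
    have h4 : y ^ 3 ≤ y ^ 4 := by nlinarith [pow_pos (by linarith : 0 < y) 3]
    nlinarith
  obtain ⟨X, hX⟩ := Filter.eventually_atTop.mp h1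
  refine ⟨max 1 ⌈X⌉₊, le_max_left _ _, fun Q hQ => ?_⟩
  have hQ1 : 1 ≤ Q := (le_max_left _ _).trans hQ
  have hQX : X ≤ Q := (Nat.le_ceil _).trans (by exact_mod_cast (le_max_right _ _).trans hQ)
  have h2 := hX Q hQX
  have h3 := Chebyshev.theta_ge (4 * Q)
  have h4 := Chebyshev.theta_le_log4_mul_x (x := Q) (by positivity)
  have hlog4 : Real.log 4 = 2 * Real.log 2 := by
    rw [show (4 : ℝ) = 2 ^ 2 by norm_num, Real.log_pow]; norm_num
  have hl2 := Real.log_two_gt_d9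
  push_cast at h3
  have h5 : Chebyshev.theta (4 * Q : ℕ) - Chebyshev.theta Q
      = ∑ p ∈ primesBetween Q, Real.log p := by
    rw [Chebyshev.theta, Chebyshev.theta, Nat.floor_natCast, Nat.floor_natCast, sub_eq_iff_eq_add,
      primesBetween, ← Finset.sum_union]
    · congr 1
      ext p; simp only [Finset.mem_filter, Finset.mem_Ioc, Finset.mem_union]
      constructor
      · rintro ⟨⟨a, b⟩, c⟩
        by_cases h : p ≤ Q
        · right; exact ⟨⟨a, h⟩, c⟩
        · left; exact ⟨⟨by omega, b⟩, c⟩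
      · rintro (⟨⟨a, b⟩, c⟩ | ⟨⟨a, b⟩, c⟩)
        · exact ⟨⟨by omega, b⟩, c⟩
        · exact ⟨⟨a, by omega⟩, c⟩
    · rw [Finset.disjoint_left]
      intro p; simp only [Finset.mem_filter, Finset.mem_Ioc]; omega
  have h6 : ∑ p ∈ primesBetween Q, Real.log p ≤ (primesBetween Q).card * Real.log (4 * Q) := by
    rw [← nsmul_eq_mul]
    refine Finset.sum_le_card_nsmul _ _ _ fun p hp => ?_
    simp only [primesBetween, Finset.mem_filter, Finset.mem_Ioc] at hp
    exact Real.log_le_log (by exact_mod_cast hp.2.pos) (by exact_mod_cast hp.1.2)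
  push_cast at h5
  have hQp : (1 : ℝ) ≤ Q := by exact_mod_cast hQ1
  nlinarith

theorem card_primesBetween_le (Q : ℕ) : (primesBetween Q).card ≤ 3 * Q := by
  refine (Finset.card_filter_le _ _).trans ?_
  simp; omega

/-- An integer of size less than `Q ^ 4` has at most three prime factors exceeding `Q`. -/
theorem card_primesBetween_dvd_le {Q : ℕ} {k : ℤ} (hk : k ≠ 0) (hkQ : k.natAbs < Q ^ 4) :
    ((primesBetween Q).filter (fun q : ℕ => (q : ℤ) ∣ k)).card ≤ 3 := by
  set s := (primesBetween Q).filter (fun q : ℕ => (q : ℤ) ∣ k) with hs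
  have hQ : 0 < Q := by
    rcases Nat.eq_zero_or_pos Q with rfl | h
    · simp at hkQ
    · exact h
  by_contra! h
  have h1 : ∏ q ∈ s, q ∣ k.natAbs := by
    apply Finset.prod_primes_dvd
    · intro q hq
      simp only [hs, primesBetween, Finset.mem_filter] at hq
      exact hq.1.2.prime
    · intro q hq
      simp only [hs, primesBetween, Finset.mem_filter] at hq
      exact Int.natCast_dvd.mp hq.2
  have h2 := Nat.le_of_dvd (Int.natAbs_pos.mpr hk) h1
  have h3 : Q ^ s.card ≤ ∏ q ∈ s, q := by
    apply Finset.pow_card_le_prod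
    intro q hq
    simp only [hs, primesBetween, Finset.mem_filter, Finset.mem_Ioc] at hq
    omega
  have h4 : Q ^ 4 ≤ Q ^ s.card := Nat.pow_le_pow_right hQ h
  omega

/-- The integer divisors, of either sign, of a nonzero integer. -/
def intDivisors (D : ℤ) : Finset ℤ :=
  D.natAbs.divisors.image (fun n : ℕ => (n : ℤ)) ∪ D.natAbs.divisors.image (fun n : ℕ => -(n : ℤ))

theorem mem_intDivisors {D x : ℤ} (hD : D ≠ 0) (h : x ∣ D) : x ∈ intDivisors D := by
  have h1 : x.natAbs ∈ D.natAbs.divisors :=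
    Nat.mem_divisors.mpr ⟨Int.natAbs_dvd_natAbs.mpr h, Int.natAbs_ne_zero.mpr hD⟩
  simp only [intDivisors, Finset.mem_union, Finset.mem_image]
  rcases Int.natAbs_eq x with h2 | h2
  · exact Or.inl ⟨_, h1, h2.symm⟩
  · exact Or.inr ⟨_, h1, h2.symm⟩

theorem card_intDivisors_le (D : ℤ) : (intDivisors D).card ≤ 2 * D.natAbs.divisors.card := by
  refine (Finset.card_union_le _ _).trans ?_
  have := Finset.card_image_le (s := D.natAbs.divisors) (f := fun n : ℕ => (n : ℤ))
  have := Finset.card_image_le (s := D.natAbs.divisors) (f := fun n : ℕ => -(n : ℤ))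
  omega

theorem exists_card_intDivisors_le (ε : ℝ) (hε : 0 < ε) :
    ∃ C : ℝ, 1 ≤ C ∧ ∀ (D : ℤ) (X : ℝ), D ≠ 0 → |(D : ℝ)| ≤ X →
      ((intDivisors D).card : ℝ) ≤ C * X ^ ε := by
  obtain ⟨C, hC1, hC⟩ := exists_card_divisors_le ε hε
  refine ⟨2 * C, by linarith, fun D X hD hX => ?_⟩
  have h1 := hC D.natAbs (Int.natAbs_ne_zero.mpr hD)
  rw [Nat.cast_natAbs, Int.cast_abs] at h1
  have h2 : ((intDivisors D).card : ℝ) ≤ 2 * (D.natAbs.divisors.card : ℝ) := by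
    exact_mod_cast card_intDivisors_le D
  have h3 : |(D : ℝ)| ^ ε ≤ X ^ ε := Real.rpow_le_rpow (abs_nonneg _) hX hε.le
  nlinarith

/-! ### Counting solutions of the cubic system in three plus three variables. -/

/-- The integers of absolute value at most `N`. -/
abbrev symmIcc (N : ℕ) : Finset ℤ := Finset.Icc (-(N : ℤ)) (N : ℤ)

/-- Triples of integers of absolute value at most `N`. -/
abbrev triples (N : ℕ) : Finset (ℤ × ℤ × ℤ) := symmIcc N ×ˢ symmIcc N ×ˢ symmIcc N

/-- The sum of the entries of a triple. -/
def tripleSum (i : ℤ × ℤ × ℤ) : ℤ := i.1 + i.2.1 + i.2.2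

/-- The sum of the cubes of the entries of a triple. -/
def tripleCubes (i : ℤ × ℤ × ℤ) : ℤ := i.1 ^ 3 + i.2.1 ^ 3 + i.2.2 ^ 3

/-- Two entries of the triple cancel and the third one equals `A`. -/
def IsCancelling (A : ℤ) (i : ℤ × ℤ × ℤ) : Prop :=
  (i.1 + i.2.1 = 0 ∧ i.2.2 = A) ∨ (i.2.1 + i.2.2 = 0 ∧ i.1 = A) ∨ (i.1 + i.2.2 = 0 ∧ i.2.1 = A)

instance (A : ℤ) (i : ℤ × ℤ × ℤ) : Decidable (IsCancelling A i) := by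
  unfold IsCancelling; infer_instance

/-- The factorisation behind the sixth moment: the two quantities fixed by the system determine a
product of pair sums, so pair sums are divisors of a known integer, or one of them vanishes. -/
theorem tripleSum_pow_sub_tripleCubes (i : ℤ × ℤ × ℤ) :
    tripleSum i ^ 3 - tripleCubes i =
      3 * (i.1 + i.2.1) * (i.2.1 + i.2.2) * (i.1 + i.2.2) := by
  simp only [tripleSum, tripleCubes]; ring

theorem IsCancelling.of_eq {i : ℤ × ℤ × ℤ} (h : tripleSum i ^ 3 = tripleCubes i) :
    IsCancelling (tripleSum i) i := by
  have h1 := tripleSum_pow_sub_tripleCubes i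
  rw [h, sub_self] at h1
  simp only [tripleSum, IsCancelling]
  rcases mul_eq_zero.mp h1.symm with h2 | h2
  · rcases mul_eq_zero.mp h2 with h3 | h3
    · left; omega
    · right; left; omega
  · right; right; omega

/-- All triples in the fibre share the nonzero integer D = 3(a+b)(b+c)(a+c), of size O(N³). The pair
sums a+b and b+c divide D, and together with a+b+c they recover the triple, so the fibre has at most
the square of the number of divisors of D. The exponent ε/6 turns (N³)^(ε/6), squared, into N^ε. -/
theorem exists_card_fiber_le (ε : ℝ) (hε : 0 < ε) :
    ∃ C : ℝ, 1 ≤ C ∧ ∀ N : ℕ, 1 ≤ N → ∀ i ∈ triples N, tripleSum i ^ 3 ≠ tripleCubes i →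
      (((triples N).filter
        fun j => tripleSum i = tripleSum j ∧ tripleCubes i = tripleCubes j).card : ℝ) ≤
        C * (N : ℝ) ^ ε := by
  obtain ⟨C, hC1, hC⟩ := exists_card_intDivisors_le (ε / 6) (by positivity)
  refine ⟨(C * 30 ^ (ε / 6)) ^ 2, ?_, fun N hN i hi hne => ?_⟩
  · have : (1 : ℝ) ≤ 30 ^ (ε / 6) := Real.one_le_rpow (by norm_num) (by positivity)
    exact one_le_pow₀ (by nlinarith)
  set D := tripleSum i ^ 3 - tripleCubes i with hD
  have hD0 : D ≠ 0 := sub_ne_zero.mpr hne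
  have hDX : |(D : ℝ)| ≤ 30 * (N : ℝ) ^ 3 := by
    rw [hD, tripleSum_pow_sub_tripleCubes]
    simp only [triples, Finset.mem_product, Finset.mem_Icc] at hi
    obtain ⟨⟨a1, a2⟩, ⟨b1, b2⟩, c1, c2⟩ := hi
    have e : ∀ x y : ℤ, -(N : ℤ) ≤ x → x ≤ N → -(N : ℤ) ≤ y → y ≤ N →
        |((x : ℝ) + y)| ≤ 2 * N := by
      intro x y h1 h2 h3 h4
      rw [abs_le]
      have : -(2 * (N : ℤ)) ≤ x + y ∧ x + y ≤ 2 * (N : ℤ) := by omega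
      exact_mod_cast this
    push_cast
    rw [abs_mul, abs_mul, abs_mul]
    calc _ ≤ 3 * (2 * (N : ℝ)) * (2 * N) * (2 * N) := by
          rw [abs_of_pos (by norm_num : (0 : ℝ) < 3)]
          gcongr
          · exact e _ _ a1 a2 b1 b2
          · exact e _ _ b1 b2 c1 c2
          · exact e _ _ a1 a2 c1 c2
      _ ≤ _ := by nlinarith [pow_nonneg (Nat.cast_nonneg (α := ℝ) N) 3]
  have hcard := hC D _ hD0 hDX
  have hle : ((triples N).filter
      fun j => tripleSum i = tripleSum j ∧ tripleCubes i = tripleCubes j).card ≤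
      (intDivisors D ×ˢ intDivisors D).card := by
    apply Finset.card_le_card_of_injOn (fun j => (j.1 + j.2.1, j.2.1 + j.2.2))
    · intro j hj
      simp only [Finset.coe_filter, Set.mem_ofPred_eq] at hj
      have hj' : D = 3 * (j.1 + j.2.1) * (j.2.1 + j.2.2) * (j.1 + j.2.2) := by
        rw [hD, hj.2.1, hj.2.2, tripleSum_pow_sub_tripleCubes]
      simp only [Finset.coe_product, Set.mem_prod, Finset.mem_coe]
      exact ⟨mem_intDivisors hD0 ⟨3 * (j.2.1 + j.2.2) * (j.1 + j.2.2), by rw [hj']; ring⟩,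
        mem_intDivisors hD0 ⟨3 * (j.1 + j.2.1) * (j.1 + j.2.2), by rw [hj']; ring⟩⟩
    · intro j hj k hk hjk
      rw [Finset.mem_coe, Finset.mem_filter] at hj hk
      simp only [tripleSum] at hj hk
      simp only [Prod.mk.injEq] at hjk
      have h1 := hj.2.1
      have h2 := hk.2.1
      ext <;> omega
  rw [Finset.card_product] at hle
  calc _ ≤ (((intDivisors D).card * (intDivisors D).card : ℕ) : ℝ) := by exact_mod_cast hle
    _ = ((intDivisors D).card : ℝ) ^ 2 := by push_cast; ring
    _ ≤ (C * (30 * (N : ℝ) ^ 3) ^ (ε / 6)) ^ 2 := by gcongr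
    _ = _ := by
      rw [Real.mul_rpow (by norm_num) (by positivity), ← mul_assoc, mul_pow]
      congr 1
      rw [← Real.rpow_natCast, ← Real.rpow_natCast, ← Real.rpow_mul (by positivity),
        ← Real.rpow_mul (by positivity)]
      congr 1; push_cast; ring

/-- Only n = −m survives; apply 2xy ≤ x² + y² and the symmetry of the interval. -/
theorem sum_neg_mul_le (N : ℕ) (b : ℤ → ℝ) :
    ∑ m ∈ symmIcc N, ∑ n ∈ symmIcc N, (if m + n = 0 then b m * b n else 0) ≤
      ∑ n ∈ symmIcc N, b n ^ 2 := by
  have h1 : ∀ m ∈ symmIcc N, ∑ n ∈ symmIcc N, (if m + n = 0 then b m * b n else 0) ≤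
      (b m ^ 2 + b (-m) ^ 2) / 2 := by
    intro m hm
    have : ∀ n ∈ symmIcc N, (if m + n = 0 then b m * b n else 0) =
        if n = -m then b m * b n else 0 := by
      intro n _; congr 1; simp only [eq_iff_iff]; omega
    rw [Finset.sum_congr rfl this, Finset.sum_ite_eq']
    split_ifs
    · nlinarith [sq_nonneg (b m - b (-m))]
    · positivity
  refine (Finset.sum_le_sum h1).trans ?_
  rw [← Finset.sum_div, Finset.sum_add_distrib]
  have : ∑ m ∈ symmIcc N, b (-m) ^ 2 = ∑ m ∈ symmIcc N, b m ^ 2 := by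
    apply Finset.sum_nbij' (fun m => -m) (fun m => -m) <;> intro m <;> simp <;> omega
  rw [this]; linarith

/-- Each of the three cancelling patterns splits into the factor b A and a sum over opposite pairs.
-/
theorem sum_isCancelling_le (N : ℕ) (b : ℤ → ℝ) (hb : ∀ n, 0 ≤ b n) (A : ℤ)
    (hA : A ∈ symmIcc N) :
    ∑ i ∈ triples N, (if IsCancelling A i then b i.1 * b i.2.1 * b i.2.2 else 0) ≤
      3 * b A * ∑ n ∈ symmIcc N, b n ^ 2 := by
  set s := ∑ n ∈ symmIcc N, b n ^ 2
  have hs := sum_neg_mul_le N b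
  have hA0 := hb A
  have h0 : ∀ i : ℤ × ℤ × ℤ, 0 ≤ b i.1 * b i.2.1 * b i.2.2 := fun i => by
    have := hb i.1; have := hb i.2.1; have := hb i.2.2; positivity
  have h1 : ∑ i ∈ triples N, (if IsCancelling A i then b i.1 * b i.2.1 * b i.2.2 else 0) ≤
      ∑ i ∈ triples N, ((if i.1 + i.2.1 = 0 ∧ i.2.2 = A then b i.1 * b i.2.1 * b i.2.2 else 0) +
        (if i.2.1 + i.2.2 = 0 ∧ i.1 = A then b i.1 * b i.2.1 * b i.2.2 else 0) +
        (if i.1 + i.2.2 = 0 ∧ i.2.1 = A then b i.1 * b i.2.1 * b i.2.2 else 0)) := by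
    refine Finset.sum_le_sum fun i _ => ?_
    have := h0 i
    have hp : ∀ P : Prop, [Decidable P] → 0 ≤ if P then b i.1 * b i.2.1 * b i.2.2 else 0 := by
      intro P _; split_ifs
      exacts [this, le_rfl]
    have p1 := hp (i.1 + i.2.1 = 0 ∧ i.2.2 = A)
    have p2 := hp (i.2.1 + i.2.2 = 0 ∧ i.1 = A)
    have p3 := hp (i.1 + i.2.2 = 0 ∧ i.2.1 = A)
    by_cases hC : IsCancelling A i
    · rw [if_pos hC]
      rcases hC with h | h | h
      · rw [if_pos h]; linarith
      · rw [if_pos h]; linarith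
      · rw [if_pos h]; linarith
    · rw [if_neg hC]; linarith
  refine h1.trans ?_
  rw [Finset.sum_add_distrib, Finset.sum_add_distrib]
  have e : ∀ P : Prop, [Decidable P] → ∀ x : ℤ, ∀ y : ℝ, (if P ∧ x = A then y else 0) =
      if x = A then (if P then y else 0) else 0 := by
    intro P _ x y; split_ifs <;> tauto
  have a1 : ∑ i ∈ triples N,
      (if i.1 + i.2.1 = 0 ∧ i.2.2 = A then b i.1 * b i.2.1 * b i.2.2 else 0) ≤ b A * s := by
    simp only [triples, Finset.sum_product, e, Finset.sum_ite_eq', hA, if_true]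
    refine le_trans (le_of_eq ?_) (mul_le_mul_of_nonneg_left hs hA0)
    rw [Finset.mul_sum]
    refine Finset.sum_congr rfl fun m _ => ?_
    rw [Finset.mul_sum]
    refine Finset.sum_congr rfl fun n _ => ?_
    split_ifs <;> ring
  have a2 : ∑ i ∈ triples N,
      (if i.2.1 + i.2.2 = 0 ∧ i.1 = A then b i.1 * b i.2.1 * b i.2.2 else 0) ≤ b A * s := by
    simp only [triples, Finset.sum_product, e]
    rw [Finset.sum_comm]
    refine le_trans (le_of_eq ?_) (mul_le_mul_of_nonneg_left hs hA0)
    rw [Finset.mul_sum]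
    refine Finset.sum_congr rfl fun m _ => ?_
    rw [Finset.sum_comm, Finset.mul_sum]
    refine Finset.sum_congr rfl fun n _ => ?_
    rw [Finset.sum_ite_eq', if_pos hA]
    split_ifs <;> ring
  have a3 : ∑ i ∈ triples N,
      (if i.1 + i.2.2 = 0 ∧ i.2.1 = A then b i.1 * b i.2.1 * b i.2.2 else 0) ≤ b A * s := by
    simp only [triples, Finset.sum_product, e]
    refine le_trans (le_of_eq ?_) (mul_le_mul_of_nonneg_left hs hA0)
    rw [Finset.mul_sum]
    refine Finset.sum_congr rfl fun m _ => ?_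
    rw [Finset.sum_comm, Finset.mul_sum]
    refine Finset.sum_congr rfl fun n _ => ?_
    rw [Finset.sum_ite_eq', if_pos hA]
    split_ifs <;> ring
  linarith

/-- The weighted count of solutions of `∑ nᵢ = ∑ mᵢ`, `∑ nᵢ³ = ∑ mᵢ³` in three plus three
variables. -/
theorem exists_sum_triples_le (ε : ℝ) (hε : 0 < ε) :
    ∃ C : ℝ, 1 ≤ C ∧ ∀ N : ℕ, 1 ≤ N → ∀ b : ℤ → ℝ, (∀ n, 0 ≤ b n) →
      ∑ i ∈ triples N, ∑ j ∈ triples N,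
        (if tripleSum i = tripleSum j ∧ tripleCubes i = tripleCubes j then
          (b i.1 * b i.2.1 * b i.2.2) * (b j.1 * b j.2.1 * b j.2.2) else 0) ≤
        C * (N : ℝ) ^ ε * (∑ n ∈ symmIcc N, b n ^ 2) ^ 3 := by
  obtain ⟨C, hC1, hC⟩ := exists_card_fiber_le ε hε
  refine ⟨C + 9, by linarith, fun N hN b hb => ?_⟩
  set s := ∑ n ∈ symmIcc N, b n ^ 2 with hs
  have hs0 : 0 ≤ s := Finset.sum_nonneg fun _ _ => by positivity
  set w : ℤ × ℤ × ℤ → ℝ := fun i => b i.1 * b i.2.1 * b i.2.2 with hw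
  have hw0 : ∀ i, 0 ≤ w i := fun i => by
    have := hb i.1; have := hb i.2.1; have := hb i.2.2; simp only [hw]; positivity
  have hw2 : ∑ i ∈ triples N, w i ^ 2 = s ^ 3 := by
    simp only [triples, Finset.sum_product, hw, mul_pow, ← Finset.mul_sum, ← Finset.sum_mul, ← hs]
    ring
  let R : ℤ × ℤ × ℤ → ℤ × ℤ × ℤ → Prop := fun i j =>
    tripleSum i = tripleSum j ∧ tripleCubes i = tripleCubes j
  let G : ℤ × ℤ × ℤ → Prop := fun i => tripleSum i ^ 3 ≠ tripleCubes i
  -- If D ≠ 0, use w i · w j ≤ (w i² + w j²)/2, so that only fibre sizes matter. If D = 0, both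
  -- triples cancel to the same A = `tripleSum i`; adding all the other A as well makes the diagonal
  -- contribution a sum of squares over A.
  have hterm : ∀ i ∈ triples N, ∀ j ∈ triples N,
      (if tripleSum i = tripleSum j ∧ tripleCubes i = tripleCubes j then w i * w j else 0) ≤
      ((if G i then (if R i j then w i ^ 2 / 2 else 0) else 0) +
        (if G j then (if R j i then w j ^ 2 / 2 else 0) else 0)) +
      ∑ A ∈ symmIcc N, (if IsCancelling A i then w i else 0) *
        (if IsCancelling A j then w j else 0) := by
    intro i hi j hj
    have hnn : 0 ≤ ∑ A ∈ symmIcc N, (if IsCancelling A i then w i else 0) *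
        (if IsCancelling A j then w j else 0) := Finset.sum_nonneg fun A _ => by
      have := hw0 i; have := hw0 j
      split_ifs <;> positivity
    by_cases hR : R i j
    · have hR' : R j i := ⟨hR.1.symm, hR.2.symm⟩
      rw [if_pos hR]
      by_cases hG : G i
      · have hG' : G j := by
          simp only [G] at hG ⊢; rwa [hR.1, hR.2] at hG
        rw [if_pos hG, if_pos hG', if_pos hR, if_pos hR']
        nlinarith [sq_nonneg (w i - w j)]
      · have hG' : ¬ G j := by
          simp only [G] at hG ⊢; rwa [hR.1, hR.2] at hG
        rw [if_neg hG, if_neg hG', zero_add, zero_add]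
        have hi' := IsCancelling.of_eq (not_not.mp hG)
        have hj' := IsCancelling.of_eq (not_not.mp hG')
        rw [← hR.1] at hj'
        have hA : tripleSum i ∈ symmIcc N := by
          simp only [triples, Finset.mem_product] at hi
          rcases hi' with h | h | h
          · exact h.2 ▸ hi.2.2
          · exact h.2 ▸ hi.1
          · exact h.2 ▸ hi.2.1
        refine le_trans (le_of_eq ?_) (Finset.single_le_sum (fun A _ => ?_) hA)
        · rw [if_pos hi', if_pos hj']
        · have := hw0 i; have := hw0 j
          split_ifs <;> positivity
    · rw [if_neg hR]
      have h1 : ∀ i j : ℤ × ℤ × ℤ, 0 ≤ (if G i then (if R i j then w i ^ 2 / 2 else 0) else 0) := by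
        intro i j; split_ifs <;> positivity
      have := h1 i j; have := h1 j i; linarith
  have hgood : ∑ i ∈ triples N, ∑ j ∈ triples N,
      (if G i then (if R i j then w i ^ 2 / 2 else 0) else 0) ≤ C * (N : ℝ) ^ ε * s ^ 3 / 2 := by
    rw [← hw2, Finset.mul_sum, Finset.sum_div]
    refine Finset.sum_le_sum fun i hi => ?_
    split_ifs with hG
    · rw [← Finset.sum_filter, Finset.sum_const, nsmul_eq_mul]
      have := hC N hN i hi hG
      have h2 : 0 ≤ w i ^ 2 / 2 := by positivity
      calc _ ≤ C * (N : ℝ) ^ ε * (w i ^ 2 / 2) := mul_le_mul_of_nonneg_right this h2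
        _ = _ := by ring
    · simp only [Finset.sum_const_zero]; positivity
  have hbad : ∑ i ∈ triples N, ∑ j ∈ triples N,
      ∑ A ∈ symmIcc N, (if IsCancelling A i then w i else 0) *
        (if IsCancelling A j then w j else 0) ≤ 9 * s ^ 3 := by
    have : ∑ i ∈ triples N, ∑ j ∈ triples N,
      ∑ A ∈ symmIcc N, (if IsCancelling A i then w i else 0) *
        (if IsCancelling A j then w j else 0) =
        ∑ A ∈ symmIcc N, (∑ i ∈ triples N, if IsCancelling A i then w i else 0) ^ 2 := by
      simp only [sq, Finset.sum_mul_sum]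
      rw [Finset.sum_comm' (s := symmIcc N) (t := fun _ => triples N) (t' := triples N)
        (s' := fun _ => symmIcc N) (by intros; tauto)]
      refine Finset.sum_congr rfl fun i _ => ?_
      rw [Finset.sum_comm]
    rw [this]
    calc _ ≤ ∑ A ∈ symmIcc N, (3 * b A * s) ^ 2 := by
          refine Finset.sum_le_sum fun A hA => ?_
          have := sum_isCancelling_le N b hb A hA
          refine pow_le_pow_left₀ (Finset.sum_nonneg fun i _ => ?_) this 2
          have := hw0 i
          split_ifs <;> positivity
      _ = 9 * s ^ 3 := by
          have e : ∀ A, (3 * b A * s) ^ 2 = 9 * s ^ 2 * b A ^ 2 := fun A => by ring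
          simp only [e]; rw [← Finset.mul_sum, ← hs]; ring
  have hN1 : (1 : ℝ) ≤ (N : ℝ) ^ ε := Real.one_le_rpow (by exact_mod_cast hN) hε.le
  calc _ ≤ _ := Finset.sum_le_sum fun i hi => Finset.sum_le_sum fun j hj => hterm i hi j hj
    _ ≤ C * (N : ℝ) ^ ε * s ^ 3 + 9 * s ^ 3 := by
      simp only [Finset.sum_add_distrib]
      rw [Finset.sum_comm (f := fun i j => (if G j then (if R j i then w j ^ 2 / 2 else 0) else 0))]
      linarith
    _ ≤ _ := by nlinarith [pow_nonneg hs0 3]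

/-! ### Exponential sums and Weyl differencing. -/

/-- The character `e^{2πix}` of `ℝ/ℤ`. -/
def expChar (x : UnitAddCircle) : ℂ := (AddCircle.toCircle x : ℂ)

theorem expChar_add (x y : UnitAddCircle) : expChar (x + y) = expChar x * expChar y := by
  simp [expChar, AddCircle.toCircle_add]

theorem expChar_zero : expChar 0 = 1 := by simp [expChar]

theorem norm_expChar (x : UnitAddCircle) : ‖expChar x‖ = 1 := Circle.norm_coe _

theorem conj_expChar (x : UnitAddCircle) : starRingEnd ℂ (expChar x) = expChar (-x) := by
  simp only [expChar, AddCircle.toCircle_neg, Circle.coe_inv_eq_conj]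

/-- For the representative r in [−1/2, 1/2] the right side is 2|sin πr|, and Jordan's inequality
applies. -/
theorem le_norm_one_sub_expChar (x : UnitAddCircle) : 4 * ‖x‖ ≤ ‖1 - expChar x‖ := by
  obtain ⟨y, rfl⟩ := QuotientAddGroup.mk_surjective x
  set r : ℝ := y - round y with hr
  have h1 : (QuotientAddGroup.mk y : UnitAddCircle) = (r : UnitAddCircle) := by
    rw [hr, AddCircle.coe_sub]
    have : ((round y : ℝ) : UnitAddCircle) = 0 := by
      rw [AddCircle.coe_eq_zero_iff]; exact ⟨round y, by simp⟩
    rw [this, sub_zero]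
  have h2 : ‖(QuotientAddGroup.mk y : UnitAddCircle)‖ = |r| := UnitAddCircle.norm_eq
  have h3 : |r| ≤ 1 / 2 := abs_sub_round y
  rw [h2, h1, expChar, AddCircle.toCircle_apply_mk, norm_sub_rev, Circle.coe_exp]
  have h4 := Complex.norm_exp_I_mul_ofReal_sub_one (2 * Real.pi / 1 * r)
  rw [mul_comm Complex.I] at h4
  rw [h4, norm_mul, Real.norm_eq_abs, Real.norm_eq_abs, abs_of_pos (by norm_num : (0 : ℝ) < 2)]
  have h5 : 2 * Real.pi / 1 * r / 2 = Real.pi * r := by ring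
  have h6 : |Real.sin (Real.pi * r)| = Real.sin (Real.pi * |r|) := by
    have hpos : 0 ≤ Real.sin (Real.pi * |r|) :=
      Real.sin_nonneg_of_nonneg_of_le_pi (by positivity) (by nlinarith [Real.pi_pos])
    rcases abs_cases r with ⟨h, _⟩ | ⟨h, _⟩
    · rw [h] at hpos ⊢; exact abs_of_nonneg hpos
    · rw [h] at hpos ⊢
      rw [mul_neg, Real.sin_neg] at hpos ⊢
      exact abs_of_nonpos (by linarith)
  rw [h5, h6]
  have := Real.mul_le_sin (x := Real.pi * |r|) (by positivity) (by nlinarith [Real.pi_pos])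
  have h7 : 2 / Real.pi * (Real.pi * |r|) = 2 * |r| := by field_simp
  linarith

theorem norm_sum_expChar_le_card (s : Finset ℤ) (φ : ℤ → UnitAddCircle) :
    ‖∑ m ∈ s, expChar (φ m)‖ ≤ s.card := by
  refine (norm_sum_le _ _).trans ?_
  simp [norm_expChar]

/-- Geometric series: multiplied by 1 − e(θ) the sum telescopes to a difference of two unimodular
numbers, while |1 − e(θ)| ≥ 4‖θ‖. -/
theorem norm_sum_expChar_linear_le (a b : ℤ) (c θ : UnitAddCircle) (hθ : θ ≠ 0) :
    ‖∑ m ∈ Finset.Icc a b, expChar (c + m • θ)‖ ≤ 1 / (2 * ‖θ‖) := by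
  have hθ0 : 0 < ‖θ‖ := norm_pos_iff.mpr hθ
  by_cases hab : a ≤ b
  · have tele : ∀ n : ℕ, (1 - expChar θ) * ∑ m ∈ Finset.Icc a (a + n), expChar (c + m • θ) =
        expChar (c + a • θ) - expChar (c + (a + n + 1) • θ) := by
      intro n
      induction n with
      | zero =>
        simp only [Nat.cast_zero, add_zero, Finset.Icc_self, Finset.sum_singleton]
        rw [add_smul a 1 θ, one_smul, ← add_assoc, expChar_add _ θ]; ring
      | succ n ih =>
        have : Finset.Icc a (a + (n + 1 : ℕ)) = insert (a + n + 1) (Finset.Icc a (a + n)) := by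
          ext x; simp only [Finset.mem_Icc, Finset.mem_insert]; push_cast; omega
        rw [this, Finset.sum_insert (by simp), mul_add, ih]
        have h2 : a + ((n + 1 : ℕ) : ℤ) + 1 = (a + n + 1) + 1 := by push_cast; ring
        rw [h2, add_smul (a + n + 1) 1 θ, one_smul, ← add_assoc c, expChar_add _ θ]; ring
    obtain ⟨n, rfl⟩ := Int.le.dest hab
    have h1 := congrArg norm (tele n)
    rw [norm_mul] at h1
    have h2 : ‖expChar (c + a • θ) - expChar (c + (a + n + 1) • θ)‖ ≤ 2 := by
      refine (norm_sub_le _ _).trans ?_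
      rw [norm_expChar, norm_expChar]; norm_num
    have h3 := le_norm_one_sub_expChar θ
    rw [le_div_iff₀ (by positivity)]
    have h4 := norm_nonneg (∑ m ∈ Finset.Icc a (a + n), expChar (c + m • θ))
    nlinarith
  · rw [Finset.Icc_eq_empty hab]; simp

/-- Weyl differencing. -/
theorem norm_sq_sum_expChar_le (L : ℕ) (a b : ℤ) (hab : b - a ≤ L) (φ : ℤ → UnitAddCircle) :
    ‖∑ m ∈ Finset.Icc a b, expChar (φ m)‖ ^ 2 ≤
      ∑ h ∈ symmIcc L, ‖∑ m ∈ Finset.Icc (max a (a - h)) (min b (b - h)),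
        expChar (φ (m + h) - φ m)‖ := by
  have h1 : ((‖∑ m ∈ Finset.Icc a b, expChar (φ m)‖ ^ 2 : ℝ) : ℂ) =
      ∑ h ∈ symmIcc L, ∑ m ∈ Finset.Icc (max a (a - h)) (min b (b - h)),
        expChar (φ (m + h) - φ m) := by
    push_cast
    rw [← Complex.conj_mul', map_sum, Finset.sum_mul_sum, Finset.sum_sigma', Finset.sum_sigma']
    refine Finset.sum_bij' (fun p _ => ⟨p.2 - p.1, p.1⟩) (fun p _ => ⟨p.2, p.2 + p.1⟩) ?_ ?_ ?_ ?_ ?_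
    · rintro ⟨m, n⟩ h
      simp only [Finset.mem_sigma, Finset.mem_Icc] at h ⊢
      omega
    · rintro ⟨m, n⟩ h
      simp only [Finset.mem_sigma, Finset.mem_Icc] at h ⊢
      omega
    · rintro ⟨m, n⟩ h; simp
    · rintro ⟨m, n⟩ h; simp
    · rintro ⟨m, n⟩ h
      simp only [conj_expChar, ← expChar_add]
      congr 1
      rw [show m + (n - m) = n by ring]; abel
  have h2 : ‖∑ m ∈ Finset.Icc a b, expChar (φ m)‖ ^ 2 = ‖∑ h ∈ symmIcc L,
      ∑ m ∈ Finset.Icc (max a (a - h)) (min b (b - h)), expChar (φ (m + h) - φ m)‖ := by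
    rw [← h1, Complex.norm_real, Real.norm_of_nonneg (by positivity)]
  rw [h2]
  exact norm_sum_le _ _

/-- The phase `n x + n³ t`. -/
def cubicPhase (x t : UnitAddCircle) (n : ℤ) : UnitAddCircle := n • x + n ^ 3 • t

/-- Two differencings, by h and then l, make the cubic phase linear in m with slope 6hl·t and remove
x altogether, which is why the bound is uniform in x. The factor 4N + 1 is the number of shifts h,
lost in the Cauchy–Schwarz step between the two. -/
theorem norm_pow_four_cubic_le (N : ℕ) (x t : UnitAddCircle) :
    ‖∑ n ∈ symmIcc N, expChar (cubicPhase x t n)‖ ^ 4 ≤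
      (4 * N + 1) * ∑ h ∈ symmIcc (2 * N), ∑ l ∈ symmIcc (2 * N),
        (if (6 * (h * l)) • t = 0 then (2 * N + 1 : ℝ) else 1 / (2 * ‖(6 * (h * l)) • t‖)) := by
  set φ := cubicPhase x t
  have h1 := norm_sq_sum_expChar_le (2 * N) (-(N : ℤ)) N (by push_cast; omega) φ
  set S : ℤ → ℂ := fun h => ∑ m ∈ Finset.Icc (max (-(N : ℤ)) (-(N : ℤ) - h)) (min (N : ℤ) (N - h)),
    expChar (φ (m + h) - φ m) with hS
  have hcard : ((symmIcc (2 * N)).card : ℝ) = 4 * N + 1 := by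
    rw [Int.card_Icc]
    have : ((2 * N : ℕ) : ℤ) + 1 - -((2 * N : ℕ) : ℤ) = ((4 * N + 1 : ℕ) : ℤ) := by push_cast; ring
    rw [this, Int.toNat_natCast]; push_cast; ring
  have h2 : ‖∑ n ∈ symmIcc N, expChar (φ n)‖ ^ 4 ≤
      (4 * N + 1) * ∑ h ∈ symmIcc (2 * N), ‖S h‖ ^ 2 := by
    calc _ = (‖∑ n ∈ symmIcc N, expChar (φ n)‖ ^ 2) ^ 2 := by ring
      _ ≤ (∑ h ∈ symmIcc (2 * N), ‖S h‖) ^ 2 := by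
        refine pow_le_pow_left₀ (by positivity) h1 2
      _ ≤ _ := by
        have := sq_sum_le_card_mul_sum_sq (s := symmIcc (2 * N)) (f := fun h => ‖S h‖)
        rwa [hcard] at this
  refine h2.trans ?_
  gcongr with h hh
  have h3 := norm_sq_sum_expChar_le (2 * N) (max (-(N : ℤ)) (-(N : ℤ) - h)) (min (N : ℤ) (N - h))
    (by push_cast; omega) (fun m => φ (m + h) - φ m)
  refine h3.trans ?_
  gcongr with l hl
  have hphase : ∀ m : ℤ, φ (m + l + h) - φ (m + l) - (φ (m + h) - φ m) =
      ((3 * h * l * (h + l)) • t) + m • ((6 * (h * l)) • t) := by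
    intro m
    simp only [φ, cubicPhase]
    module
  simp only [hphase]
  split_ifs with h0
  · refine (norm_sum_expChar_le_card _ _).trans ?_
    rw [Int.card_Icc]
    have : ∀ z : ℤ, z ≤ ((2 * N + 1 : ℕ) : ℤ) → ((z.toNat : ℕ) : ℝ) ≤ 2 * N + 1 := by
      intro z hz
      have : z.toNat ≤ 2 * N + 1 := by omega
      exact_mod_cast this
    apply this; push_cast; omega
  · exact norm_sum_expChar_linear_le _ _ _ _ h0

/-! ### Reciprocal sums near a rational point and Weyl's inequality. -/

theorem norm_nsmul_div (q m w : ℕ) :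
    ‖w • (((m : ℝ) / q * 1 : ℝ) : UnitAddCircle)‖ =
      (min (w * m % q) (q - w * m % q) : ℕ) / (q : ℝ) := by
  have h : w • (((m : ℝ) / q * 1 : ℝ) : UnitAddCircle) =
      ((((w * m : ℕ) : ℝ) / q * 1 : ℝ) : UnitAddCircle) := by
    rw [← AddCircle.coe_nsmul]; congr 1; push_cast; rw [nsmul_eq_mul]; ring
  rw [h]
  have := AddCircle.norm_div_natCast (p := (1 : ℝ)) (m := w * m) (n := q)
  rw [this, one_mul]

/-- Write u = m/q with m prime to q. Then w ↦ wm mod q permutes the nonzero residues r, the distance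
to 0 is min(r, q − r)/q, and bounding 1/min by 1/r + 1/(q − r) leaves two harmonic sums. -/
theorem sum_inv_norm_nsmul_le (q : ℕ) (hq : 0 < q) (u : UnitAddCircle) (hu : addOrderOf u = q) :
    ∑ w ∈ Finset.Ico 1 q, 1 / ‖w • u‖ ≤ 2 * q * (1 + Real.log q) := by
  obtain ⟨m, hm, hgcd, rfl⟩ := (AddCircle.addOrderOf_eq_pos_iff hq).mp hu
  set f : ℕ → ℝ := fun r => 1 / (((min r (q - r) : ℕ) : ℝ) / (q : ℝ)) with hf
  set σ : ℕ → ℕ := fun w => w * m % q with hσ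
  have hcop : Nat.Coprime q m := Nat.coprime_comm.mp hgcd
  have hmem : ∀ w ∈ Finset.Ico 1 q, σ w ∈ Finset.Ico 1 q := by
    intro w hw
    simp only [Finset.mem_Ico] at hw ⊢
    refine ⟨Nat.one_le_iff_ne_zero.mpr fun h0 => ?_, Nat.mod_lt _ hq⟩
    have := Nat.Coprime.dvd_of_dvd_mul_right hcop (Nat.dvd_of_mod_eq_zero h0)
    exact absurd (Nat.le_of_dvd (by omega) this) (by omega)
  have hinj : Set.InjOn σ (Finset.Ico 1 q : Set ℕ) := by
    intro w hw w' hw' h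
    simp only [Finset.coe_Ico, Set.mem_Ico] at hw hw'
    have h1 : w ≡ w' [MOD q] := Nat.ModEq.cancel_right_of_coprime hcop h
    have := Nat.ModEq.eq_of_lt_of_lt h1 hw.2 hw'.2
    exact this
  have h1 : ∑ w ∈ Finset.Ico 1 q, 1 / ‖w • (((m : ℝ) / q * 1 : ℝ) : UnitAddCircle)‖ =
      ∑ w ∈ Finset.Ico 1 q, f (σ w) := by
    refine Finset.sum_congr rfl fun w _ => ?_
    rw [norm_nsmul_div q m w]
  have h2 : ∑ w ∈ Finset.Ico 1 q, f (σ w) ≤ ∑ r ∈ Finset.Ico 1 q, f r := by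
    rw [← Finset.sum_image hinj]
    refine Finset.sum_le_sum_of_subset_of_nonneg ?_ fun _ _ _ => by simp only [hf]; positivity
    intro r hr
    obtain ⟨w, hw, rfl⟩ := Finset.mem_image.mp hr
    exact hmem w hw
  have h3 : ∑ r ∈ Finset.Ico 1 q, f r ≤ ∑ r ∈ Finset.Ico 1 q, ((q : ℝ) / r + q / ((q - r : ℕ) : ℝ)) := by
    refine Finset.sum_le_sum fun r hr => ?_
    simp only [hf, one_div_div]
    rcases min_choice r (q - r) with h | h <;> rw [h]
    · have : (0 : ℝ) ≤ q / ((q - r : ℕ) : ℝ) := by positivity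
      linarith
    · have : (0 : ℝ) ≤ q / (r : ℝ) := by positivity
      linarith
  have h4 : ∑ r ∈ Finset.Ico 1 q, (q : ℝ) / ((q - r : ℕ) : ℝ) = ∑ r ∈ Finset.Ico 1 q, (q : ℝ) / r := by
    refine Finset.sum_nbij' (fun r => q - r) (fun r => q - r) ?_ ?_ ?_ ?_ ?_ <;>
      intro r hr <;> simp only [Finset.mem_Ico] at hr ⊢ <;> omega
  have h5 : ∑ r ∈ Finset.Ico 1 q, (q : ℝ) / r ≤ q * (1 + Real.log q) := by
    have e1 : ∑ r ∈ Finset.Ico 1 q, (1 : ℝ) / r ≤ (harmonic q : ℝ) := by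
      rw [harmonic_eq_sum_Icc]
      push_cast
      simp only [one_div]
      refine Finset.sum_le_sum_of_subset_of_nonneg ?_ fun _ _ _ => by positivity
      intro r; simp only [Finset.mem_Ico, Finset.mem_Icc]; omega
    have e2 := harmonic_le_one_add_log q
    have e3 : ∑ r ∈ Finset.Ico 1 q, (q : ℝ) / r = q * ∑ r ∈ Finset.Ico 1 q, (1 : ℝ) / r := by
      rw [Finset.mul_sum]; refine Finset.sum_congr rfl fun _ _ => by ring
    rw [e3]; gcongr; linarith
  rw [h1]
  rw [Finset.sum_add_distrib, h4] at h3
  linarith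

/-- A nonzero multiple of u is at distance at least 1/q from 0, whereas replacing u by t moves the
w-th multiple by at most 1/(4q). -/
theorem norm_nsmul_le_of_near {q : ℕ} (hq : 0 < q) {u t : UnitAddCircle} (hu : addOrderOf u = q)
    (ht : ‖t - u‖ ≤ 1 / (4 * (q : ℝ) ^ 2)) {w : ℕ} (hw : w ∈ Finset.Ico 1 q) :
    0 < ‖w • u‖ ∧ 3 / 4 * ‖w • u‖ ≤ ‖w • t‖ := by
  simp only [Finset.mem_Ico] at hw
  have hwu : w • u ≠ 0 := by
    intro h
    have := addOrderOf_dvd_of_nsmul_eq_zero h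
    rw [hu] at this
    exact absurd (Nat.le_of_dvd (by omega) this) (by omega)
  have hfin : IsOfFinAddOrder (w • u) := (addOrderOf_pos_iff.mp (hu ▸ hq)).nsmul
  have h1 := AddCircle.le_add_order_smul_norm_of_isOfFinAddOrder hfin hwu
  have h2 : addOrderOf (w • u) ≤ q := by
    refine Nat.le_of_dvd hq (addOrderOf_dvd_of_nsmul_eq_zero ?_)
    rw [smul_comm, ← hu, addOrderOf_nsmul_eq_zero, smul_zero]
  have hq' : (0 : ℝ) < q := by exact_mod_cast hq
  have h3 : 1 ≤ q * ‖w • u‖ := by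
    rw [nsmul_eq_mul] at h1
    have : (addOrderOf (w • u) : ℝ) ≤ q := by exact_mod_cast h2
    nlinarith [norm_nonneg (w • u)]
  have h4 : ‖w • t - w • u‖ ≤ w * (1 / (4 * (q : ℝ) ^ 2)) := by
    rw [← nsmul_sub]
    exact (norm_nsmul_le).trans (by gcongr)
  have h5 : w * (1 / (4 * (q : ℝ) ^ 2)) ≤ 1 / (4 * q) := by
    have : (w : ℝ) ≤ q := by exact_mod_cast hw.2.le
    calc _ ≤ q * (1 / (4 * (q : ℝ) ^ 2)) := by gcongr
      _ = _ := by field_simp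
  have h6 : 1 / (4 * (q : ℝ)) ≤ 1 / 4 * ‖w • u‖ := by
    rw [div_le_iff₀ (by positivity)]; nlinarith
  have h7 : ‖w • u‖ - ‖w • t‖ ≤ ‖w • t - w • u‖ := by
    rw [norm_sub_rev]; exact norm_sub_norm_le _ _
  exact ⟨norm_pos_iff.mpr hwu, by linarith⟩

theorem sum_inv_norm_zsmul_le {q : ℕ} (hq : 0 < q) {u t : UnitAddCircle} (hu : addOrderOf u = q)
    (ht : ‖t - u‖ ≤ 1 / (4 * (q : ℝ) ^ 2)) :
    ∑ w ∈ (Finset.Ioo (-(q : ℤ)) q).filter (fun w => w ≠ 0), 1 / (2 * ‖w • t‖) ≤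
      3 * q * (1 + Real.log q) := by
  have h1 : ∑ w ∈ (Finset.Ioo (-(q : ℤ)) q).filter (fun w => w ≠ 0), 1 / (2 * ‖w • t‖) =
      ∑ w ∈ Finset.Ico 1 q, 1 / ‖w • t‖ := by
    have hsplit : (Finset.Ioo (-(q : ℤ)) q).filter (fun w => w ≠ 0) =
        (Finset.Ico 1 q).image (fun w : ℕ => (w : ℤ)) ∪
          (Finset.Ico 1 q).image (fun w : ℕ => -(w : ℤ)) := by
      ext x
      simp only [Finset.mem_filter, Finset.mem_Ioo, Finset.mem_union, Finset.mem_image,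
        Finset.mem_Ico]
      constructor
      · rintro ⟨⟨a, b⟩, c⟩
        rcases lt_or_gt_of_ne c with h | h
        · right; exact ⟨x.natAbs, by omega, by omega⟩
        · left; exact ⟨x.natAbs, by omega, by omega⟩
      · rintro (⟨w, hw, rfl⟩ | ⟨w, hw, rfl⟩) <;> omega
    rw [hsplit, Finset.sum_union, Finset.sum_image (by intro a _ b _ h; simpa using h),
      Finset.sum_image (by intro a _ b _ h; simpa using h), ← Finset.sum_add_distrib]
    · refine Finset.sum_congr rfl fun w _ => ?_
      rw [neg_smul, norm_neg, natCast_zsmul]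
      rw [one_div, one_div, mul_inv]; ring
    · rw [Finset.disjoint_left]
      intro x hx hy
      simp only [Finset.mem_image, Finset.mem_Ico] at hx hy
      obtain ⟨a, ha, rfl⟩ := hx
      obtain ⟨b, hb, hb'⟩ := hy
      omega
  rw [h1]
  have h2 : ∑ w ∈ Finset.Ico 1 q, 1 / ‖w • t‖ ≤ ∑ w ∈ Finset.Ico 1 q, (4 / 3) * (1 / ‖w • u‖) := by
    refine Finset.sum_le_sum fun w hw => ?_
    obtain ⟨a, b⟩ := norm_nsmul_le_of_near hq hu ht hw
    rw [← div_eq_mul_one_div, div_le_div_iff₀ (by linarith) a]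
    linarith
  rw [← Finset.mul_sum] at h2
  have h3 := sum_inv_norm_nsmul_le q hq u hu
  have h4 : 0 ≤ q * (1 + Real.log q) := by
    have := Real.log_natCast_nonneg q
    positivity
  nlinarith

/-- Weyl's inequality for the cubic sum near a point of order `q > 24 N²`. -/
theorem exists_weyl_bound (ε : ℝ) (hε : 0 < ε) :
    ∃ C : ℝ, 1 ≤ C ∧ ∀ N : ℕ, 1 ≤ N → ∀ q : ℕ, 24 * N ^ 2 < q → ∀ x t u : UnitAddCircle,
      addOrderOf u = q → ‖t - u‖ ≤ 1 / (4 * (q : ℝ) ^ 2) →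
      ‖∑ n ∈ symmIcc N, expChar (cubicPhase x t n)‖ ^ 4 ≤ C * N * (q : ℝ) ^ (1 + ε) := by
  obtain ⟨C, hC1, hC⟩ := exists_card_intDivisors_le (ε / 2) (by positivity)
  refine ⟨150 + 15 * C * (1 + 2 / ε), ?_, fun N hN q hq x t u hu ht => ?_⟩
  · have : 0 < C * (1 + 2 / ε) := by positivity
    linarith
  have hq0 : 0 < q := by omega
  have hqR : (1 : ℝ) ≤ q := by exact_mod_cast hq0
  have hNR : (1 : ℝ) ≤ N := by exact_mod_cast hN
  have h24 : 24 * (N : ℝ) ^ 2 ≤ q := by exact_mod_cast hq.le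
  set g : ℤ → ℝ := fun w => 1 / (2 * ‖w • t‖) with hg
  have hg0 : ∀ w, 0 ≤ g w := fun w => by simp only [hg]; positivity
  set J := symmIcc (2 * N)
  set J' := J.filter (fun h => h ≠ 0) with hJ'
  set W := (Finset.Ioo (-(q : ℤ)) q).filter (fun w => w ≠ 0) with hW
  have hmain := norm_pow_four_cubic_le N x t
  -- Here q > 24N² enters: |6hl| ≤ 24N² < q, so the slopes stay within one period and avoid nonzero
  -- multiples of q.
  have hmaps : ∀ p ∈ J' ×ˢ J', 6 * (p.1 * p.2) ∈ W := by
    rintro ⟨h, l⟩ hp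
    simp only [hJ', J, Finset.mem_product, Finset.mem_filter, Finset.mem_Icc] at hp
    obtain ⟨⟨⟨a1, a2⟩, a3⟩, ⟨b1, b2⟩, b3⟩ := hp
    have h1 : |h * l| ≤ (2 * N) * (2 * N) := by
      rw [abs_mul]
      push_cast at a1 a2 b1 b2
      exact mul_le_mul (abs_le.mpr ⟨a1, a2⟩) (abs_le.mpr ⟨b1, b2⟩) (abs_nonneg _) (by positivity)
    have h2 := abs_le.mp h1
    have h3 : 24 * (N : ℤ) ^ 2 < q := by exact_mod_cast hq
    simp only [hW, Finset.mem_filter, Finset.mem_Ioo]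
    refine ⟨⟨by nlinarith, by nlinarith⟩, ?_⟩
    simp [a3, b3]
  have hne : ∀ w ∈ W, w • t ≠ 0 := by
    intro w hw
    simp only [hW, Finset.mem_filter, Finset.mem_Ioo] at hw
    have hw' : w.natAbs ∈ Finset.Ico 1 q := by simp only [Finset.mem_Ico]; omega
    obtain ⟨a, b⟩ := norm_nsmul_le_of_near hq0 hu ht hw'
    have h1 : w.natAbs • t ≠ 0 := norm_pos_iff.mp (by linarith)
    intro h0
    apply h1
    rcases Int.natAbs_eq w with h | h
    · rw [h, natCast_zsmul] at h0; exact h0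
    · rw [h, neg_smul, natCast_zsmul, neg_eq_zero] at h0; exact h0
  -- h divides w and determines l, so the multiplicity of w is controlled by the divisor bound.
  have hrep : ∀ w ∈ W, (((J' ×ˢ J').filter (fun p => 6 * (p.1 * p.2) = w)).card : ℝ) ≤
      C * (q : ℝ) ^ (ε / 2) := by
    intro w hw
    simp only [hW, Finset.mem_filter, Finset.mem_Ioo] at hw
    have hwR : |(w : ℝ)| ≤ q := by
      rw [abs_le]; exact ⟨by exact_mod_cast hw.1.1.le, by exact_mod_cast hw.1.2.le⟩
    refine le_trans ?_ (hC w q hw.2 hwR)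
    rw [Nat.cast_le]
    apply Finset.card_le_card_of_injOn Prod.fst
    · rintro ⟨h, l⟩ hp
      rw [Finset.mem_coe, Finset.mem_filter] at hp
      exact mem_intDivisors hw.2 ⟨6 * l, by rw [← hp.2]; ring⟩
    · rintro ⟨h, l⟩ hp ⟨h', l'⟩ hp' hh
      rw [Finset.mem_coe, Finset.mem_filter] at hp hp'
      simp only at hh hp hp'
      subst hh
      have h3 : h ≠ 0 := by
        simp only [hJ', Finset.mem_product, Finset.mem_filter] at hp; exact hp.1.1.2
      have h4 : h * l = h * l' := by omega
      rw [mul_left_cancel₀ h3 h4]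
  have hoff : ∑ h ∈ J', ∑ l ∈ J', g (6 * (h * l)) ≤
      C * (q : ℝ) ^ (ε / 2) * (3 * q * (1 + Real.log q)) := by
    rw [← Finset.sum_product (f := fun p : ℤ × ℤ => g (6 * (p.1 * p.2))),
      ← Finset.sum_fiberwise_of_maps_to hmaps]
    calc _ = ∑ w ∈ W, (((J' ×ˢ J').filter (fun p => 6 * (p.1 * p.2) = w)).card : ℝ) * g w := by
          refine Finset.sum_congr rfl fun w _ => ?_
          rw [← nsmul_eq_mul, ← Finset.sum_const]
          refine Finset.sum_congr rfl fun p hp => ?_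
          rw [(Finset.mem_filter.mp hp).2]
      _ ≤ ∑ w ∈ W, C * (q : ℝ) ^ (ε / 2) * g w := by
          refine Finset.sum_le_sum fun w hw => ?_
          exact mul_le_mul_of_nonneg_right (hrep w hw) (hg0 w)
      _ ≤ _ := by
          rw [← Finset.mul_sum]
          gcongr
          exact sum_inv_norm_zsmul_le hq0 hu ht
  have hcardJ : (J.card : ℝ) = 4 * N + 1 := by
    rw [Int.card_Icc]
    have : ((2 * N : ℕ) : ℤ) + 1 - -((2 * N : ℕ) : ℤ) = ((4 * N + 1 : ℕ) : ℤ) := by push_cast; ring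
    rw [this, Int.toNat_natCast]; push_cast; ring
  have hterm : ∀ h ∈ J, ∀ l ∈ J,
      (if (6 * (h * l)) • t = 0 then (2 * N + 1 : ℝ) else 1 / (2 * ‖(6 * (h * l)) • t‖)) ≤
      ((if h = 0 then (2 * N + 1 : ℝ) else 0) + (if l = 0 then (2 * N + 1 : ℝ) else 0)) +
        (if h ≠ 0 then (if l ≠ 0 then g (6 * (h * l)) else 0) else 0) := by
    intro h hh l hl
    have hN0 : (0 : ℝ) ≤ 2 * N + 1 := by positivity
    by_cases h0 : h = 0
    · subst h0; simp; split_ifs <;> linarith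
    by_cases l0 : l = 0
    · subst l0; simp; split_ifs <;> linarith
    have : 6 * (h * l) ∈ W := hmaps (h, l) (by simp [hJ', hh, hl, h0, l0])
    rw [if_neg (hne _ this), if_neg h0, if_neg l0, if_pos h0, if_pos l0]
    simp [hg]
  have hsum : ∑ h ∈ J, ∑ l ∈ J,
      (if (6 * (h * l)) • t = 0 then (2 * N + 1 : ℝ) else 1 / (2 * ‖(6 * (h * l)) • t‖)) ≤
      2 * ((4 * N + 1) * (2 * N + 1)) + C * (q : ℝ) ^ (ε / 2) * (3 * q * (1 + Real.log q)) := by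
    refine (Finset.sum_le_sum fun h hh => Finset.sum_le_sum fun l hl => hterm h hh l hl).trans ?_
    have h0J : (0 : ℤ) ∈ J := by simp [J]
    simp only [Finset.sum_add_distrib, Finset.sum_ite_eq', h0J, if_true, Finset.sum_const,
      nsmul_eq_mul, hcardJ]
    have e1 : ∑ h ∈ J, ∑ l ∈ J, (if h ≠ 0 then (if l ≠ 0 then g (6 * (h * l)) else 0) else 0) =
        ∑ h ∈ J', ∑ l ∈ J', g (6 * (h * l)) := by
      rw [hJ', Finset.sum_filter]
      refine Finset.sum_congr rfl fun h _ => ?_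
      by_cases h0 : h = 0
      · simp [h0]
      · simp only [if_pos (show h ≠ 0 from h0), Finset.sum_filter]
    have e2 : ∑ h ∈ J, (4 * (N : ℝ) + 1) * (if h = 0 then (2 * N + 1 : ℝ) else 0) =
        (4 * N + 1) * (2 * N + 1) := by
      rw [← Finset.mul_sum, Finset.sum_ite_eq', if_pos h0J]
    rw [e1, e2]
    linarith
  have hlog : 1 + Real.log q ≤ (1 + 2 / ε) * (q : ℝ) ^ (ε / 2) := by
    have e1 := Real.log_le_rpow_div (x := q) (by positivity) (half_pos hε)
    have e2 : (1 : ℝ) ≤ (q : ℝ) ^ (ε / 2) := Real.one_le_rpow hqR (by positivity)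
    have e3 : (q : ℝ) ^ (ε / 2) / (ε / 2) = 2 / ε * (q : ℝ) ^ (ε / 2) := by field_simp
    rw [e3] at e1
    linarith
  have hqq : (q : ℝ) ^ (1 + ε) = q * ((q : ℝ) ^ (ε / 2) * (q : ℝ) ^ (ε / 2)) := by
    rw [← Real.rpow_add (by positivity), Real.rpow_add (by positivity), Real.rpow_one]
    congr 2; ring
  set y := (q : ℝ) ^ (ε / 2) with hy
  have hy1 : 1 ≤ y := Real.one_le_rpow hqR (by positivity)
  -- The degenerate shifts h = 0 or l = 0 give O(N³) in total, which is O(Nq) since q > 24N².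
  have b1 : (4 * (N : ℝ) + 1) * (2 * ((4 * N + 1) * (2 * N + 1))) ≤ 150 * N * (q * (y * y)) := by
    have c1 : (4 * (N : ℝ) + 1) * (2 * ((4 * N + 1) * (2 * N + 1))) ≤
        (5 * (N : ℝ)) * (2 * ((5 * N) * (3 * N))) := by gcongr <;> linarith
    have c2 : (1 : ℝ) ≤ y * y := by nlinarith
    have c3 : (N : ℝ) ^ 2 ≤ q * (y * y) := by nlinarith [sq_nonneg (N : ℝ)]
    nlinarith
  have b2 : (4 * (N : ℝ) + 1) * (C * y * (3 * q * (1 + Real.log q))) ≤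
      15 * C * (1 + 2 / ε) * N * (q * (y * y)) := by
    calc _ ≤ (5 * (N : ℝ)) * (C * y * (3 * q * ((1 + 2 / ε) * y))) := by
          have : 0 ≤ 1 + Real.log q := by have := Real.log_natCast_nonneg q; linarith
          gcongr; linarith
      _ = _ := by ring
  rw [hqq]
  calc _ ≤ _ := hmain
    _ ≤ (4 * N + 1) * (2 * ((4 * N + 1) * (2 * N + 1)) + C * y * (3 * q * (1 + Real.log q))) := by
      gcongr
    _ ≤ _ := by linarith

/-! ### Fourier analysis on the torus: Parseval and convolution kernels. -/

instance : IsProbabilityMeasure torusMeasure := by unfold torusMeasure; infer_instance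

instance : torusMeasure.IsAddHaarMeasure := by unfold torusMeasure; infer_instance

theorem mFourierCoeff_eq (f : Torus2 → ℂ) (m : Fin 2 → ℤ) :
    UnitAddTorus.mFourierCoeff f m = ∫ z, UnitAddTorus.mFourier (-m) z * f z ∂torusMeasure := rfl

theorem norm_mFourier_apply (m : Fin 2 → ℤ) (z : Torus2) : ‖UnitAddTorus.mFourier m z‖ = 1 := by
  simp only [UnitAddTorus.mFourier, ContinuousMap.coe_mk, fourier_apply, norm_prod]
  exact Finset.prod_eq_one fun i _ => Circle.norm_coe _

theorem mFourier_apply_add (m : Fin 2 → ℤ) (z w : Torus2) :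
    UnitAddTorus.mFourier m (z + w) = UnitAddTorus.mFourier m z * UnitAddTorus.mFourier m w := by
  simp [UnitAddTorus.mFourier, fourier_apply, AddCircle.toCircle_add]
  ring

theorem integral_mFourier (m : Fin 2 → ℤ) :
    ∫ z, UnitAddTorus.mFourier m z ∂torusMeasure = if m = 0 then 1 else 0 := by
  have h := orthonormal_iff_ite.mp (UnitAddTorus.orthonormal_mFourier (d := Fin 2)) 0 m
  simp only [UnitAddTorus.mFourierLp, ContinuousMap.inner_toLp, ← UnitAddTorus.mFourier_neg,
    ← UnitAddTorus.mFourier_add, neg_zero, add_zero, eq_comm (a := (0 : Fin 2 → ℤ))] at h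
  exact h

theorem mFourier_cubicFreq (n : ℤ) (z : Torus2) :
    UnitAddTorus.mFourier (cubicFreq n) z = expChar (cubicPhase (z 0) (z 1) n) := by
  simp [UnitAddTorus.mFourier, cubicFreq, cubicPhase, fourier_apply, expChar, AddCircle.toCircle_add]

theorem integrable_of_bounded {f : Torus2 → ℂ} (hf : Measurable f) {B : ℝ} (hB : ∀ z, ‖f z‖ ≤ B) :
    Integrable f torusMeasure :=
  Integrable.of_bound hf.aestronglyMeasurable B (Filter.Eventually.of_forall hB)

/-- The index map v need not be injective, so orthogonality leaves the coincidences v i = v j. This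
is how the sixth moment becomes a weighted count of solutions. -/
theorem integral_norm_sq_sum_mFourier_le {ι : Type*} (s : Finset ι) (c : ι → ℂ)
    (v : ι → Fin 2 → ℤ) :
    ∫ z, ‖∑ i ∈ s, c i * UnitAddTorus.mFourier (v i) z‖ ^ 2 ∂torusMeasure ≤
      ∑ i ∈ s, ∑ j ∈ s, if v i = v j then ‖c i‖ * ‖c j‖ else 0 := by
  have h1 : ∀ z, ((‖∑ i ∈ s, c i * UnitAddTorus.mFourier (v i) z‖ ^ 2 : ℝ) : ℂ) =
      ∑ i ∈ s, ∑ j ∈ s, (c i * starRingEnd ℂ (c j)) * UnitAddTorus.mFourier (v i + -v j) z := by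
    intro z
    push_cast
    rw [← Complex.mul_conj', map_sum, Finset.sum_mul_sum]
    refine Finset.sum_congr rfl fun i _ => Finset.sum_congr rfl fun j _ => ?_
    rw [UnitAddTorus.mFourier_add, UnitAddTorus.mFourier_neg, map_mul]
    ring
  have hint : ∀ m : Fin 2 → ℤ, ∀ a : ℂ,
      Integrable (fun z => a * UnitAddTorus.mFourier m z) torusMeasure := fun m a =>
    (integrable_of_bounded (UnitAddTorus.mFourier m).continuous.measurable
      (fun z => (norm_mFourier_apply m z).le)).const_mul a
  have h2 : ((∫ z, ‖∑ i ∈ s, c i * UnitAddTorus.mFourier (v i) z‖ ^ 2 ∂torusMeasure : ℝ) : ℂ) =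
      ∑ i ∈ s, ∑ j ∈ s, if v i = v j then c i * starRingEnd ℂ (c j) else 0 := by
    rw [← integral_complex_ofReal]
    simp only [h1]
    rw [integral_finsetSum _ fun i _ => integrable_finsetSum _ fun j _ => hint _ _]
    refine Finset.sum_congr rfl fun i _ => ?_
    rw [integral_finsetSum _ fun j _ => hint _ _]
    refine Finset.sum_congr rfl fun j _ => ?_
    rw [integral_const_mul, integral_mFourier]
    simp only [add_neg_eq_zero, mul_ite, mul_one, mul_zero]
  have h3 := congrArg norm h2
  rw [Complex.norm_real, Real.norm_of_nonneg (integral_nonneg fun z => by positivity)] at h3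
  rw [h3]
  refine (norm_sum_le _ _).trans (Finset.sum_le_sum fun i _ => (norm_sum_le _ _).trans
    (Finset.sum_le_sum fun j _ => ?_))
  split_ifs
  · rw [norm_mul, RCLike.norm_conj]
  · simp

/-- Parseval's identity for a bounded measurable function. -/
theorem hasSum_prod_mFourierCoeff_of_bounded {f g : Torus2 → ℂ} (hf : Measurable f)
    (hg : Measurable g) {B B' : ℝ} (hB : ∀ z, ‖f z‖ ≤ B) (hB' : ∀ z, ‖g z‖ ≤ B') :
    HasSum (fun m => starRingEnd ℂ (UnitAddTorus.mFourierCoeff f m) *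
      UnitAddTorus.mFourierCoeff g m) (∫ z, starRingEnd ℂ (f z) * g z ∂torusMeasure) := by
  have hf2 : MemLp f 2 torusMeasure := MemLp.of_bound hf.aestronglyMeasurable B (.of_forall hB)
  have hg2 : MemLp g 2 torusMeasure := MemLp.of_bound hg.aestronglyMeasurable B' (.of_forall hB')
  have h := UnitAddTorus.hasSum_prod_mFourierCoeff (d := Fin 2) (hf2.toLp f) (hg2.toLp g)
  have e : ∀ (F : Torus2 → ℂ) (hF : MemLp F 2 torusMeasure) (m : Fin 2 → ℤ),
      UnitAddTorus.mFourierCoeff (hF.toLp F) m = UnitAddTorus.mFourierCoeff F m := by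
    intro F hF m
    rw [mFourierCoeff_eq, mFourierCoeff_eq]
    refine integral_congr_ae ?_
    filter_upwards [hF.coeFn_toLp] with z hz
    rw [hz]
  have e2 : ∫ z, starRingEnd ℂ (hf2.toLp f z) * hg2.toLp g z ∂torusMeasure =
      ∫ z, starRingEnd ℂ (f z) * g z ∂torusMeasure := by
    refine integral_congr_ae ?_
    filter_upwards [hf2.coeFn_toLp, hg2.coeFn_toLp] with z hz hz'
    rw [hz, hz']
  have e3 : (fun m => starRingEnd ℂ (UnitAddTorus.mFourierCoeff f m) *
      UnitAddTorus.mFourierCoeff g m) =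
      fun m => starRingEnd ℂ (UnitAddTorus.mFourierCoeff (hf2.toLp f) m) *
        UnitAddTorus.mFourierCoeff (hg2.toLp g) m := by
    funext m; rw [e f hf2, e g hg2]
  rw [← e2, e3]
  exact h

/-- Convolution on the torus. -/
def conv (H f : Torus2 → ℂ) (z : Torus2) : ℂ := ∫ w, H (z - w) * f w ∂torusMeasure

theorem measurable_conv {H f : Torus2 → ℂ} (hH : Measurable H) (hf : Measurable f) :
    Measurable (conv H f) := by
  have : StronglyMeasurable (fun p : Torus2 × Torus2 => H (p.1 - p.2) * f p.2) :=
    ((hH.comp measurable_sub).mul (hf.comp measurable_snd)).stronglyMeasurable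
  exact this.integral_prod_right.measurable

theorem norm_conv_le {H f : Torus2 → ℂ} (hf : Measurable f) {M B : ℝ}
    (hM : ∀ z, ‖H z‖ ≤ M) (hB : ∀ z, ‖f z‖ ≤ B) (z : Torus2) :
    ‖conv H f z‖ ≤ M * ∫ w, ‖f w‖ ∂torusMeasure := by
  rw [← integral_const_mul]
  refine norm_integral_le_of_norm_le ((integrable_of_bounded hf hB).norm.const_mul M)
    (.of_forall fun w => ?_)
  rw [norm_mul]
  exact mul_le_mul_of_nonneg_right (hM _) (norm_nonneg _)

theorem mFourierCoeff_conv {H f : Torus2 → ℂ} (hH : Measurable H) (hf : Measurable f) {M B : ℝ}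
    (hM : ∀ z, ‖H z‖ ≤ M) (hB : ∀ z, ‖f z‖ ≤ B)
    (m : Fin 2 → ℤ) :
    UnitAddTorus.mFourierCoeff (conv H f) m =
      UnitAddTorus.mFourierCoeff H m * UnitAddTorus.mFourierCoeff f m := by
  have hM0 : 0 ≤ M := (norm_nonneg _).trans (hM 0)
  simp only [mFourierCoeff_eq, conv]
  simp_rw [← integral_const_mul]
  rw [integral_integral_swap]
  · have : ∀ w, ∫ z, UnitAddTorus.mFourier (-m) z * (H (z - w) * f w) ∂torusMeasure =
        (∫ z, UnitAddTorus.mFourier (-m) z * H z ∂torusMeasure) *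
          (UnitAddTorus.mFourier (-m) w * f w) := by
      intro w
      rw [← integral_add_right_eq_self _ w, ← integral_mul_const]
      refine integral_congr_ae (.of_forall fun z => ?_)
      simp only [mFourier_apply_add, add_sub_cancel_right]
      ring
    simp_rw [this]
  · refine Integrable.of_bound (C := M * B) ?_ (.of_forall fun p => ?_)
    · exact (((UnitAddTorus.mFourier (-m)).continuous.measurable.comp measurable_fst).mul
        ((hH.comp measurable_sub).mul (hf.comp measurable_snd))).aestronglyMeasurable
    · simp only [Function.uncurry]
      rw [norm_mul, norm_mul, norm_mFourier_apply, one_mul]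
      exact mul_le_mul (hM _) (hB _) (norm_nonneg _) hM0

theorem hasSum_mFourierCoeff_mul_norm_sq {H f : Torus2 → ℂ} (hH : Measurable H) (hf : Measurable f) {M B : ℝ}
    (hM : ∀ z, ‖H z‖ ≤ M) (hB : ∀ z, ‖f z‖ ≤ B) :
    HasSum (fun m => UnitAddTorus.mFourierCoeff H m *
      ((‖UnitAddTorus.mFourierCoeff f m‖ ^ 2 : ℝ) : ℂ))
      (∫ z, starRingEnd ℂ (f z) * conv H f z ∂torusMeasure) := by
  have h := hasSum_prod_mFourierCoeff_of_bounded hf (measurable_conv hH hf) hB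
    (norm_conv_le hf hM hB)
  convert h using 2 with m
  rw [mFourierCoeff_conv hH hf hM hB]
  push_cast
  rw [← Complex.conj_mul']
  ring

theorem norm_integral_conj_mul_conv_le {H f : Torus2 → ℂ} (hf : Measurable f) {M B : ℝ}
    (hM : ∀ z, ‖H z‖ ≤ M) (hB : ∀ z, ‖f z‖ ≤ B) :
    ‖∫ z, starRingEnd ℂ (f z) * conv H f z ∂torusMeasure‖ ≤
      M * (∫ w, ‖f w‖ ∂torusMeasure) ^ 2 := by
  have : M * (∫ w, ‖f w‖ ∂torusMeasure) ^ 2 =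
      ∫ w, ‖f w‖ * (M * ∫ w, ‖f w‖ ∂torusMeasure) ∂torusMeasure := by
    rw [integral_mul_const]; ring
  rw [this]
  refine norm_integral_le_of_norm_le ((integrable_of_bounded hf hB).norm.mul_const _)
    (.of_forall fun w => ?_)
  rw [norm_mul, RCLike.norm_conj]
  exact mul_le_mul_of_nonneg_left (norm_conv_le hf hM hB w) (norm_nonneg _)

/-- If the Fourier coefficients of the kernel `H` equal `c₀` on a finite set `S` and are at most `δ`
elsewhere, the restriction of `f̂` to `S` is controlled. -/
theorem sum_norm_sq_mFourierCoeff_le {H f : Torus2 → ℂ} (hH : Measurable H) (hf : Measurable f)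
    {M B : ℝ} (hM : ∀ z, ‖H z‖ ≤ M) (hB : ∀ z, ‖f z‖ ≤ B) (S : Finset (Fin 2 → ℤ)) {c₀ δ : ℝ}
    (hc₀ : 0 ≤ c₀) (hδ : 0 ≤ δ)
    (hS : ∀ m ∈ S, UnitAddTorus.mFourierCoeff H m = c₀)
    (hS' : ∀ m ∉ S, ‖UnitAddTorus.mFourierCoeff H m‖ ≤ δ) :
    c₀ * ∑ m ∈ S, ‖UnitAddTorus.mFourierCoeff f m‖ ^ 2 ≤
      M * (∫ w, ‖f w‖ ∂torusMeasure) ^ 2 + δ * ∫ w, ‖f w‖ ^ 2 ∂torusMeasure := by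
  have h1 := hasSum_mFourierCoeff_mul_norm_sq hH hf hM hB
  have h2 := norm_integral_conj_mul_conv_le hf hM hB
  have h3 : HasSum (fun m => ‖UnitAddTorus.mFourierCoeff f m‖ ^ 2)
      (∫ w, ‖f w‖ ^ 2 ∂torusMeasure) := by
    have := hasSum_prod_mFourierCoeff_of_bounded hf hf hB hB
    rw [← Complex.hasSum_ofReal, ← integral_complex_ofReal]
    have e : ∀ z : ℂ, ((‖z‖ ^ 2 : ℝ) : ℂ) = starRingEnd ℂ z * z := fun z => by
      push_cast; rw [← Complex.conj_mul']
    simp only [e]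
    exact this
  have h4 : HasSum (fun m => if m ∈ S then
      (c₀ : ℂ) * ((‖UnitAddTorus.mFourierCoeff f m‖ ^ 2 : ℝ) : ℂ) else 0)
      (∑ m ∈ S, (c₀ : ℂ) * ((‖UnitAddTorus.mFourierCoeff f m‖ ^ 2 : ℝ) : ℂ)) := by
    rw [Finset.sum_congr rfl fun m hm => (if_pos hm).symm]
    exact hasSum_sum_of_ne_finset_zero fun m hm => if_neg hm
  -- Removing the part c₀·|f̂|² over S from the full quadratic form leaves coefficients of size at
  -- most δ; Parseval sums the remainder to δ‖f‖₂².
  have h5 := (h1.sub h4).norm_le_of_bounded (h3.mul_left δ) (fun m => by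
    by_cases hm : m ∈ S
    · rw [if_pos hm, hS m hm, sub_self, norm_zero]; positivity
    · rw [if_neg hm, sub_zero, norm_mul, Complex.norm_real, Real.norm_of_nonneg (by positivity)]
      exact mul_le_mul_of_nonneg_right (hS' m hm) (by positivity))
  have h6 : ‖∑ m ∈ S, (c₀ : ℂ) * ((‖UnitAddTorus.mFourierCoeff f m‖ ^ 2 : ℝ) : ℂ)‖ =
      c₀ * ∑ m ∈ S, ‖UnitAddTorus.mFourierCoeff f m‖ ^ 2 := by
    rw [← Finset.mul_sum, ← Complex.ofReal_sum, ← Complex.ofReal_mul, Complex.norm_real,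
      Real.norm_of_nonneg (mul_nonneg hc₀ (Finset.sum_nonneg fun _ _ => by positivity))]
  rw [← h6]
  have h7 := norm_sub_norm_le (∑ m ∈ S, (c₀ : ℂ) * ((‖UnitAddTorus.mFourierCoeff f m‖ ^ 2 : ℝ) : ℂ))
    (∫ z, starRingEnd ℂ (f z) * conv H f z ∂torusMeasure)
  rw [norm_sub_rev] at h7
  linarith

/-! ### Arcs around fractions and their Fourier coefficients. -/

/-- The indicator function of the arc of radius `δ` around `u`. -/
def arc (u : UnitAddCircle) (δ : ℝ) (t : UnitAddCircle) : ℂ := if ‖t - u‖ ≤ δ then 1 else 0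

theorem measurable_arc (u : UnitAddCircle) (δ : ℝ) : Measurable (arc u δ) := by
  refine Measurable.ite ?_ measurable_const measurable_const
  exact measurableSet_le (measurable_norm.comp (measurable_id.sub_const u)) measurable_const

theorem norm_arc_le (u : UnitAddCircle) (δ : ℝ) (t : UnitAddCircle) : ‖arc u δ t‖ ≤ 1 := by
  unfold arc; split_ifs <;> simp

theorem fourier_eq_expChar (k : ℤ) (t : UnitAddCircle) : fourier k t = expChar (k • t) := rfl

theorem fourierCoeff_eq (g : UnitAddCircle → ℂ) (k : ℤ) :
    fourierCoeff g k = ∫ t, expChar (-(k • t)) * g t ∂AddCircle.haarAddCircle := by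
  simp only [fourierCoeff, smul_eq_mul, fourier_eq_expChar, neg_smul]

theorem fourierCoeff_arc (u : UnitAddCircle) (δ : ℝ) (k : ℤ) :
    fourierCoeff (arc u δ) k = expChar (-(k • u)) * fourierCoeff (arc 0 δ) k := by
  rw [fourierCoeff_eq, fourierCoeff_eq, ← integral_add_right_eq_self _ u, ← integral_const_mul]
  refine integral_congr_ae (.of_forall fun t => ?_)
  simp only [arc, add_sub_cancel_right, sub_zero, smul_add, neg_add, expChar_add]
  ring

theorem fourierCoeff_arc_zero {δ : ℝ} (hδ : 0 ≤ δ) (hδ' : 2 * δ ≤ 1) :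
    fourierCoeff (arc 0 δ) 0 = ((2 * δ : ℝ) : ℂ) := by
  rw [fourierCoeff_eq]
  have h1 : ∀ t, expChar (-((0 : ℤ) • t)) * arc 0 δ t =
      (Metric.closedBall (0 : UnitAddCircle) δ).indicator (fun _ => (1 : ℂ)) t := by
    intro t
    simp [expChar_zero, arc, Set.indicator, Metric.mem_closedBall, dist_eq_norm]
  simp only [h1]
  rw [integral_indicator_const _ Metric.isClosed_closedBall.measurableSet]
  have h2 : (AddCircle.haarAddCircle : Measure UnitAddCircle).real (Metric.closedBall 0 δ) =
      2 * δ := by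
    have h3 := AddCircle.volume_closedBall (T := (1 : ℝ)) (x := 0) δ
    rw [AddCircle.volume_eq_smul_haarAddCircle, ENNReal.ofReal_one, one_smul, min_eq_right hδ'] at h3
    rw [Measure.real, h3, ENNReal.toReal_ofReal (by linarith)]
  rw [h2]; simp

theorem norm_fourierCoeff_arc_le {δ : ℝ} (hδ : 0 ≤ δ) (hδ' : 2 * δ ≤ 1) (k : ℤ) :
    ‖fourierCoeff (arc 0 δ) k‖ ≤ 2 * δ := by
  have h1 : ‖fourierCoeff (arc 0 δ) k‖ ≤ ∫ t, ‖arc 0 δ t‖ ∂AddCircle.haarAddCircle := by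
    rw [fourierCoeff_eq]
    refine (norm_integral_le_integral_norm _).trans (le_of_eq ?_)
    simp only [norm_mul, norm_expChar, one_mul]
  have h2 := fourierCoeff_arc_zero hδ hδ'
  rw [fourierCoeff_eq] at h2
  have h3 : ∀ t, expChar (-((0 : ℤ) • t)) * arc 0 δ t = ((‖arc 0 δ t‖ : ℝ) : ℂ) := by
    intro t
    simp only [zero_smul, neg_zero, expChar_zero, one_mul, arc]
    split_ifs <;> simp
  simp only [h3] at h2
  rw [integral_complex_ofReal, Complex.ofReal_inj] at h2
  linarith

/-- Integrating the exponential explicitly leaves two boundary terms of size 1/(2π|k|). This decay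
is needed only for very large k, where k may have many prime factors in (Q, 4Q]. -/
theorem norm_fourierCoeff_arc_le_inv {δ : ℝ} (hδ : 0 ≤ δ) (hδ' : 2 * δ < 1) {k : ℤ} (hk : k ≠ 0) :
    ‖fourierCoeff (arc 0 δ) k‖ ≤ 1 / |(k : ℝ)| := by
  rw [fourierCoeff_eq_intervalIntegral _ _ (-(1 / 2 : ℝ))]
  have h1 : ∫ x in (-(1 / 2 : ℝ))..(-(1 / 2) + 1),
      fourier (-k) (x : UnitAddCircle) • arc 0 δ (x : UnitAddCircle) =
      ∫ x in (-δ)..δ, fourier (-k) (x : UnitAddCircle) := by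
    rw [intervalIntegral.integral_of_le (by norm_num), intervalIntegral.integral_of_le (by linarith),
      ← integral_Icc_eq_integral_Ioc (x := -δ)]
    have e : ∀ x ∈ Set.Ioc (-(1 / 2 : ℝ)) (-(1 / 2) + 1),
        fourier (-k) (x : UnitAddCircle) • arc 0 δ (x : UnitAddCircle) =
        (Set.Icc (-δ) δ).indicator (fun x : ℝ => (fourier (-k) (x : UnitAddCircle) : ℂ)) x := by
      intro x hx
      have hx2 : |x| ≤ 1 / 2 := abs_le.mpr ⟨hx.1.le, by linarith [hx.2]⟩
      have hn : ‖(x : UnitAddCircle)‖ = |x| :=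
        (AddCircle.norm_coe_eq_abs_iff (1 : ℝ) one_ne_zero).mpr (by rw [abs_one]; exact hx2)
      simp only [arc, sub_zero, hn, Set.indicator, Set.mem_Icc, ← abs_le]
      split_ifs <;> simp
    rw [setIntegral_congr_fun measurableSet_Ioc e, setIntegral_indicator measurableSet_Icc]
    congr 2
    ext x
    simp only [Set.mem_inter_iff, Set.mem_Ioc, Set.mem_Icc]
    constructor
    · exact fun h => h.2
    · exact fun h => ⟨⟨by linarith [h.1], by linarith [h.2]⟩, h⟩
  rw [h1]
  have h2 : ∫ x in (-δ)..δ, (fourier (-k) (x : UnitAddCircle) : ℂ) =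
      (1 : ℝ) / (-2 * Real.pi * Complex.I * k) * fourier (-k) ((δ : ℝ) : UnitAddCircle) -
      (1 : ℝ) / (-2 * Real.pi * Complex.I * k) * fourier (-k) ((-δ : ℝ) : UnitAddCircle) := by
    refine intervalIntegral.integral_eq_sub_of_hasDerivAt
      (fun x _ => has_antideriv_at_fourier_neg (T := 1) ⟨one_pos⟩ hk x) ?_
    refine Continuous.intervalIntegrable ?_ _ _
    exact (map_continuous (fourier (-k))).comp (AddCircle.continuous_mk' 1)
  rw [h2, div_one, one_smul]
  have h3 : ‖((1 : ℝ) : ℂ) / (-2 * Real.pi * Complex.I * k)‖ = 1 / (2 * Real.pi * |(k : ℝ)|) := by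
    simp [abs_of_pos Real.pi_pos]
  refine (norm_sub_le _ _).trans ?_
  rw [norm_mul, norm_mul, h3, fourier_eq_expChar, fourier_eq_expChar, norm_expChar, norm_expChar]
  have hk' : 0 < |(k : ℝ)| := abs_pos.mpr (by exact_mod_cast hk)
  have : 1 / (2 * Real.pi * |(k : ℝ)|) ≤ 1 / (2 * 1 * |(k : ℝ)|) := by
    gcongr; linarith [Real.pi_gt_three]
  have h5 : 1 / (2 * 1 * |(k : ℝ)|) + 1 / (2 * 1 * |(k : ℝ)|) = 1 / |(k : ℝ)| := by field_simp; norm_num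
  linarith

/-- The point `1 / q` of the circle. -/
def unitFrac (q : ℕ) : UnitAddCircle := (((1 : ℝ) / q : ℝ) : UnitAddCircle)

theorem addOrderOf_unitFrac {q : ℕ} (hq : 0 < q) : addOrderOf (unitFrac q) = q :=
  AddCircle.addOrderOf_period_div (p := (1 : ℝ)) hq

theorem addOrderOf_nsmul_unitFrac {q a : ℕ} (hq : q.Prime) (ha : a ∈ Finset.Ico 1 q) :
    addOrderOf (a • unitFrac q) = q := by
  have := Fact.mk hq
  rw [Finset.mem_Ico] at ha
  apply addOrderOf_eq_prime
  · rw [smul_comm]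
    have := addOrderOf_nsmul_eq_zero (unitFrac q)
    rw [addOrderOf_unitFrac hq.pos] at this
    rw [this, smul_zero]
  · intro h
    have := addOrderOf_dvd_of_nsmul_eq_zero h
    rw [addOrderOf_unitFrac hq.pos] at this
    exact absurd (Nat.le_of_dvd (by omega) this) (by omega)

theorem eq_zero_of_expChar_eq_one {x : UnitAddCircle} (h : expChar x = 1) : x = 0 := by
  have := le_norm_one_sub_expChar x
  rw [h, sub_self, norm_zero] at this
  exact norm_le_zero_iff.mp (by linarith)

theorem sum_expChar_nsmul_unitFrac {q : ℕ} (hq : 0 < q) (k : ℤ) :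
    ∑ a ∈ Finset.Ico 1 q, expChar (-(k • (a • unitFrac q))) =
      (if (q : ℤ) ∣ k then (q : ℂ) else 0) - 1 := by
  set ζ := expChar (-(k • unitFrac q)) with hζ
  have h1 : ∀ a : ℕ, expChar (-(k • (a • unitFrac q))) = ζ ^ a := by
    intro a
    induction a with
    | zero => simp [expChar_zero]
    | succ a ih => rw [pow_succ, ← ih, hζ, ← expChar_add]; congr 1; module
  simp only [h1]
  have h2 : ∑ a ∈ Finset.range q, ζ ^ a = if (q : ℤ) ∣ k then (q : ℂ) else 0 := by
    have hdvd : (q : ℤ) ∣ k ↔ k • unitFrac q = 0 := by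
      rw [← addOrderOf_dvd_iff_zsmul_eq_zero, addOrderOf_unitFrac hq]
    split_ifs with h
    · have : ζ = 1 := by rw [hζ, hdvd.mp h, neg_zero, expChar_zero]
      simp [this]
    · have hne : ζ ≠ 1 := fun h0 => h (hdvd.mpr (neg_eq_zero.mp (eq_zero_of_expChar_eq_one h0)))
      have h3 : ζ ^ q = 1 := by
        rw [← h1]
        have := addOrderOf_nsmul_eq_zero (unitFrac q)
        rw [addOrderOf_unitFrac hq] at this
        rw [this, smul_zero, neg_zero, expChar_zero]
      rw [geom_sum_eq hne, h3]; simp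
  rw [← h2, Finset.range_eq_Ico, Finset.sum_eq_sum_Ico_succ_bot hq]
  simp

/-! ### The union of arcs around fractions of prime denominator. -/

/-- The radius of the arcs used at height `Q`. -/
def arcRadius (Q : ℕ) : ℝ := 1 / (64 * (Q : ℝ) ^ 2)

/-- The indicator function of the union of the arcs of radius `arcRadius Q` around the points of
prime order `q ∈ (Q, 4Q]`. -/
def primeArcs (Q : ℕ) (t : UnitAddCircle) : ℂ :=
  ∑ q ∈ primesBetween Q, ∑ a ∈ Finset.Ico 1 q, arc (a • unitFrac q) (arcRadius Q) t

theorem mem_primesBetween {Q q : ℕ} : q ∈ primesBetween Q ↔ (Q < q ∧ q ≤ 4 * Q) ∧ q.Prime := by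
  simp [primesBetween]

theorem measurable_primeArcs (Q : ℕ) : Measurable (primeArcs Q) :=
  Finset.measurable_fun_sum _ fun _ _ => Finset.measurable_fun_sum _ fun _ _ => measurable_arc _ _

theorem exists_near_of_primeArcs_ne_zero {Q : ℕ} {t : UnitAddCircle} (h : primeArcs Q t ≠ 0) :
    ∃ q ∈ primesBetween Q, ∃ u : UnitAddCircle, addOrderOf u = q ∧ ‖t - u‖ ≤ arcRadius Q := by
  obtain ⟨q, hq, h1⟩ := Finset.exists_ne_zero_of_sum_ne_zero h
  obtain ⟨a, ha, h2⟩ := Finset.exists_ne_zero_of_sum_ne_zero h1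
  refine ⟨q, hq, a • unitFrac q, addOrderOf_nsmul_unitFrac (mem_primesBetween.mp hq).2 ha, ?_⟩
  by_contra h3
  exact h2 (if_neg h3)

/-- The arcs are disjoint: distinct centres differ by a nonzero point of order at most qq' ≤ 16Q²,
hence lie at least 1/(16Q²) apart, while the centres of two arcs that meet are within 1/(32Q²). -/
theorem norm_primeArcs_le (Q : ℕ) (t : UnitAddCircle) : ‖primeArcs Q t‖ ≤ 1 := by
  have h1 : primeArcs Q t = ∑ p ∈ (primesBetween Q).sigma fun q => Finset.Ico 1 q,
      if ‖t - p.2 • unitFrac p.1‖ ≤ arcRadius Q then (1 : ℂ) else 0 := by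
    rw [Finset.sum_sigma]; rfl
  rw [h1, ← Finset.sum_filter, Finset.sum_const, nsmul_eq_mul, mul_one, Complex.norm_natCast]
  have h2 : (((primesBetween Q).sigma fun q => Finset.Ico 1 q).filter
      fun p => ‖t - p.2 • unitFrac p.1‖ ≤ arcRadius Q).card ≤ 1 := by
    rw [Finset.card_le_one]
    rintro ⟨q, a⟩ h ⟨q', a'⟩ h'
    simp only [Finset.mem_filter, Finset.mem_sigma] at h h'
    obtain ⟨⟨hq, ha⟩, h⟩ := h
    obtain ⟨⟨hq', ha'⟩, h'⟩ := h'
    obtain ⟨⟨hq1, hq2⟩, hqp⟩ := mem_primesBetween.mp hq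
    obtain ⟨⟨hq1', hq2'⟩, hqp'⟩ := mem_primesBetween.mp hq'
    have o := addOrderOf_nsmul_unitFrac hqp ha
    have o' := addOrderOf_nsmul_unitFrac hqp' ha'
    set u := a • unitFrac q with hu
    set u' := a' • unitFrac q' with hu'
    have hQ : 0 < Q := by
      rcases Nat.eq_zero_or_pos Q with rfl | h0
      · omega
      · exact h0
    have hdist : ‖u - u'‖ ≤ 2 * arcRadius Q := by
      have : u - u' = (t - u') - (t - u) := by abel
      rw [this]
      refine (norm_sub_le _ _).trans (by linarith)
    have heq : u = u' := by
      by_contra hne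
      have hD : u - u' ≠ 0 := sub_ne_zero.mpr hne
      have hz : (q * q') • (u - u') = 0 := by
        have z1 : q • u = 0 := by rw [← o]; exact addOrderOf_nsmul_eq_zero u
        have z2 : q' • u' = 0 := by rw [← o']; exact addOrderOf_nsmul_eq_zero u'
        rw [smul_sub, mul_comm q q', mul_smul, z1, mul_comm q' q, mul_smul, z2]; simp
      have hqq : 0 < q * q' := Nat.mul_pos hqp.pos hqp'.pos
      have hfin : IsOfFinAddOrder (u - u') :=
        isOfFinAddOrder_iff_nsmul_eq_zero.mpr ⟨q * q', hqq, hz⟩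
      have h5 := AddCircle.le_add_order_smul_norm_of_isOfFinAddOrder hfin hD
      have h6 : addOrderOf (u - u') ≤ 16 * Q ^ 2 := by
        refine (Nat.le_of_dvd hqq (addOrderOf_dvd_of_nsmul_eq_zero hz)).trans ?_
        calc q * q' ≤ (4 * Q) * (4 * Q) := Nat.mul_le_mul hq2 hq2'
          _ = _ := by ring
      have h7 : (addOrderOf (u - u') : ℝ) ≤ 16 * (Q : ℝ) ^ 2 := by exact_mod_cast h6
      rw [nsmul_eq_mul] at h5
      have h8 : (1 : ℝ) ≤ 16 * (Q : ℝ) ^ 2 * (2 * arcRadius Q) :=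
        h5.trans (mul_le_mul h7 hdist (norm_nonneg _) (by positivity))
      have h9 : 16 * (Q : ℝ) ^ 2 * (2 * arcRadius Q) = 1 / 2 := by
        have : (Q : ℝ) ≠ 0 := by positivity
        unfold arcRadius; field_simp; norm_num
      rw [h9] at h8; norm_num at h8
    have hqq : q = q' := by rw [← o, heq, o']
    subst hqq
    have haa : a = a' := by
      refine nsmul_injOn_Iio_addOrderOf (x := unitFrac q) ?_ ?_ heq <;>
        rw [addOrderOf_unitFrac hqp.pos] <;> simp only [Finset.mem_Ico] at ha ha'
      · exact ha.2
      · exact ha'.2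
    rw [haa]
  exact_mod_cast h2

theorem integrable_circle {g : UnitAddCircle → ℂ} (hg : Measurable g) (hB : ∀ t, ‖g t‖ ≤ 1) :
    Integrable g AddCircle.haarAddCircle :=
  Integrable.of_bound hg.aestronglyMeasurable 1 (.of_forall hB)

theorem continuous_expChar : Continuous expChar :=
  continuous_subtype_val.comp AddCircle.continuous_toCircle

/-- Translating an arc multiplies its coefficient by a character value, so summing over the
numerators a produces the Ramanujan sum of the prime q. -/
theorem fourierCoeff_primeArcs (Q : ℕ) (k : ℤ) :
    fourierCoeff (primeArcs Q) k = fourierCoeff (arc 0 (arcRadius Q)) k *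
      ∑ q ∈ primesBetween Q, ((if (q : ℤ) ∣ k then (q : ℂ) else 0) - 1) := by
  have hint : ∀ u δ, Integrable (fun t => expChar (-(k • t)) * arc u δ t)
      AddCircle.haarAddCircle := by
    intro u δ
    refine integrable_circle ?_ fun t => ?_
    · exact (continuous_expChar.measurable.comp (by fun_prop)).mul (measurable_arc u δ)
    · rw [norm_mul, norm_expChar, one_mul]; exact norm_arc_le u δ t
  have h1 : fourierCoeff (primeArcs Q) k = ∑ q ∈ primesBetween Q, ∑ a ∈ Finset.Ico 1 q,
      fourierCoeff (arc (a • unitFrac q) (arcRadius Q)) k := by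
    simp only [fourierCoeff_eq, primeArcs, Finset.mul_sum]
    rw [integral_finsetSum _ fun q _ => integrable_finsetSum _ fun a _ => hint _ _]
    refine Finset.sum_congr rfl fun q _ => ?_
    rw [integral_finsetSum _ fun a _ => hint _ _]
  rw [h1, Finset.mul_sum]
  refine Finset.sum_congr rfl fun q hq => ?_
  rw [← sum_expChar_nsmul_unitFrac (mem_primesBetween.mp hq).2.pos, Finset.mul_sum]
  refine Finset.sum_congr rfl fun a _ => ?_
  rw [fourierCoeff_arc, mul_comm]

theorem arcRadius_nonneg (Q : ℕ) : 0 ≤ arcRadius Q := by unfold arcRadius; positivity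

theorem two_mul_arcRadius_lt {Q : ℕ} (hQ : 1 ≤ Q) : 2 * arcRadius Q < 1 := by
  have : (1 : ℝ) ≤ Q := by exact_mod_cast hQ
  unfold arcRadius
  rw [← mul_div_assoc, div_lt_one (by positivity)]
  nlinarith

/-- The mean value of `primeArcs Q`. -/
def primeArcsMean (Q : ℕ) : ℝ := 2 * arcRadius Q * ∑ q ∈ primesBetween Q, ((q : ℝ) - 1)

theorem fourierCoeff_primeArcs_zero {Q : ℕ} (hQ : 1 ≤ Q) :
    fourierCoeff (primeArcs Q) 0 = primeArcsMean Q := by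
  rw [fourierCoeff_primeArcs, fourierCoeff_arc_zero (arcRadius_nonneg Q) (two_mul_arcRadius_lt hQ).le]
  simp [primeArcsMean]

theorem le_primeArcsMean {Q : ℕ} (hQ : 1 ≤ Q) :
    ((primesBetween Q).card : ℝ) / (32 * Q) ≤ primeArcsMean Q := by
  have h1 : (primesBetween Q).card • (Q : ℝ) ≤ ∑ q ∈ primesBetween Q, ((q : ℝ) - 1) := by
    refine Finset.card_nsmul_le_sum _ _ _ fun q hq => ?_
    have : Q + 1 ≤ q := (mem_primesBetween.mp hq).1.1
    have : (Q : ℝ) + 1 ≤ q := by exact_mod_cast this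
    linarith
  rw [nsmul_eq_mul] at h1
  have hQ0 : (0 : ℝ) < Q := by exact_mod_cast hQ
  calc _ = 2 * arcRadius Q * ((primesBetween Q).card * (Q : ℝ)) := by
        unfold arcRadius; field_simp; ring
    _ ≤ _ := by
        unfold primeArcsMean
        have := arcRadius_nonneg Q
        gcongr

/-- If |k| < Q⁴, at most three of the primes divide k, so the Ramanujan sums total at most 3·4Q + 3Q
= 15Q, against an arc coefficient of at most 1/(32Q²). If |k| ≥ Q⁴, the trivial O(Q²) bound for
these sums is beaten by the decay 1/|k| of the arc coefficient. -/
theorem norm_fourierCoeff_primeArcs_le {Q : ℕ} (hQ : 1 ≤ Q) {k : ℤ} (hk : k ≠ 0) :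
    ‖fourierCoeff (primeArcs Q) k‖ ≤ 15 / Q := by
  have hQ1 : (1 : ℝ) ≤ Q := by exact_mod_cast hQ
  have hP : ((primesBetween Q).card : ℝ) ≤ 3 * Q := by exact_mod_cast card_primesBetween_le Q
  have hsum : ‖∑ q ∈ primesBetween Q, ((if (q : ℤ) ∣ k then (q : ℂ) else 0) - 1)‖ ≤
      ((primesBetween Q).filter (fun q : ℕ => (q : ℤ) ∣ k)).card * (4 * Q) + 3 * Q := by
    rw [Finset.sum_sub_distrib, Finset.sum_const, nsmul_eq_mul, mul_one]
    refine (norm_sub_le _ _).trans ?_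
    rw [Complex.norm_natCast, ← Finset.sum_filter]
    refine add_le_add ?_ hP
    refine (norm_sum_le _ _).trans ?_
    rw [← nsmul_eq_mul]
    refine Finset.sum_le_card_nsmul _ _ _ fun q hq => ?_
    rw [Complex.norm_natCast]
    exact_mod_cast (mem_primesBetween.mp (Finset.mem_filter.mp hq).1).1.2
  rw [fourierCoeff_primeArcs, norm_mul]
  have hr := arcRadius_nonneg Q
  by_cases hkQ : k.natAbs < Q ^ 4
  · have h1 : (((primesBetween Q).filter (fun q : ℕ => (q : ℤ) ∣ k)).card : ℝ) ≤ 3 := by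
      exact_mod_cast card_primesBetween_dvd_le hk hkQ
    calc _ ≤ (2 * arcRadius Q) * (3 * (4 * Q) + 3 * Q) := by
          gcongr
          · exact norm_fourierCoeff_arc_le hr (two_mul_arcRadius_lt hQ).le k
          · exact hsum.trans (by gcongr)
      _ = (15 / 32) / Q := by unfold arcRadius; field_simp; norm_num
      _ ≤ _ := by gcongr; norm_num
  · have h1 : (((primesBetween Q).filter (fun q : ℕ => (q : ℤ) ∣ k)).card : ℝ) ≤ 3 * Q := by
      refine le_trans ?_ hP
      exact_mod_cast Finset.card_filter_le _ _
    have hk4 : (Q : ℝ) ^ 4 ≤ |(k : ℝ)| := by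
      have : Q ^ 4 ≤ k.natAbs := not_lt.mp hkQ
      rw [← Int.cast_abs, ← Nat.cast_natAbs]; exact_mod_cast this
    calc _ ≤ (1 / (Q : ℝ) ^ 4) * (3 * Q * (4 * Q) + 3 * Q) := by
          gcongr
          · refine (norm_fourierCoeff_arc_le_inv hr (two_mul_arcRadius_lt hQ) hk).trans ?_
            gcongr
          · exact hsum.trans (by gcongr)
      _ ≤ (1 / (Q : ℝ) ^ 4) * (15 * (Q : ℝ) ^ 3) := by
          gcongr
          nlinarith [mul_nonneg (by linarith : (0 : ℝ) ≤ Q - 1) (sq_nonneg (Q : ℝ))]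
      _ = _ := by field_simp

/-! ### The localised kernel and the restriction inequality it yields. -/

theorem cubicFreq_injective : Function.Injective cubicFreq := fun m n h => by
  simpa [cubicFreq] using congrFun h 0

/-- The Dirichlet-type kernel `∑_{|n| ≤ N} e^{2πi(nx + n³t)}` localised to the prime arcs. -/
def arcKernel (N Q : ℕ) (z : Torus2) : ℂ :=
  (∑ n ∈ symmIcc N, UnitAddTorus.mFourier (cubicFreq n) z) * primeArcs Q (z 1)

theorem measurable_arcKernel (N Q : ℕ) : Measurable (arcKernel N Q) :=
  (Finset.measurable_fun_sum _ fun n _ =>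
    (UnitAddTorus.mFourier (cubicFreq n)).continuous.measurable).mul
    ((measurable_primeArcs Q).comp (measurable_pi_apply 1))

theorem integral_mFourier_mul_snd (m : Fin 2 → ℤ) {g : UnitAddCircle → ℂ} :
    ∫ z, UnitAddTorus.mFourier m z * g (z 1) ∂torusMeasure =
      if m 0 = 0 then fourierCoeff g (-m 1) else 0 := by
  have h1 : ∀ z : Torus2, UnitAddTorus.mFourier m z * g (z 1) =
      ∏ i, (![fun t => fourier (m 0) t, fun t => fourier (m 1) t * g t] :
        Fin 2 → UnitAddCircle → ℂ) i (z i) := by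
    intro z
    simp [UnitAddTorus.mFourier, Fin.prod_univ_two, mul_assoc]
  simp only [h1, torusMeasure]
  rw [integral_fintype_prod_eq_prod, Fin.prod_univ_two]
  simp only [Matrix.cons_val_zero, Matrix.cons_val_one]
  have h2 : ∫ t, (fourier (m 0) t : ℂ) ∂(AddCircle.haarAddCircle : Measure UnitAddCircle) =
      if m 0 = 0 then 1 else 0 := by
    have := integral_mFourier ![m 0, 0]
    have e : ∀ z : Torus2, UnitAddTorus.mFourier ![m 0, 0] z =
      ∏ i, (![fun t => fourier (m 0) t, fun _ => 1] : Fin 2 → UnitAddCircle → ℂ) i (z i) := by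
      intro z
      simp [UnitAddTorus.mFourier, Fin.prod_univ_two]
    simp only [e, torusMeasure] at this
    rw [integral_fintype_prod_eq_prod, Fin.prod_univ_two] at this
    simpa [funext_iff, Fin.forall_fin_two] using this
  rw [h2]
  have h3 : ∫ t, fourier (m 1) t * g t ∂(AddCircle.haarAddCircle : Measure UnitAddCircle) =
      fourierCoeff g (-m 1) := by
    simp only [fourierCoeff, neg_neg, smul_eq_mul]
  rw [h3]; split_ifs <;> simp

theorem integrable_mFourier_mul_primeArcs (Q : ℕ) (v : Fin 2 → ℤ) :
    Integrable (fun z : Torus2 => UnitAddTorus.mFourier v z * primeArcs Q (z 1)) torusMeasure := by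
  refine integrable_of_bounded (B := 1) ?_ fun z => ?_
  · exact (UnitAddTorus.mFourier v).continuous.measurable.mul
      ((measurable_primeArcs Q).comp (measurable_pi_apply 1))
  · rw [norm_mul, norm_mFourier_apply, one_mul]; exact norm_primeArcs_le _ _

/-- Multiplying by a function of t alone smears each frequency (n, n³) vertically: points of the
curve see the mean of `primeArcs Q`, other points see only its nonzero frequencies. -/
theorem mFourierCoeff_arcKernel (N Q : ℕ) (m : Fin 2 → ℤ) :
    UnitAddTorus.mFourierCoeff (arcKernel N Q) m =
      if m 0 ∈ symmIcc N then fourierCoeff (primeArcs Q) (m 1 - m 0 ^ 3) else 0 := by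
  have h1 : ∀ z, UnitAddTorus.mFourier (-m) z * arcKernel N Q z =
      ∑ n ∈ symmIcc N, UnitAddTorus.mFourier (cubicFreq n + -m) z * primeArcs Q (z 1) := by
    intro z
    rw [arcKernel, Finset.sum_mul, Finset.mul_sum]
    refine Finset.sum_congr rfl fun n _ => ?_
    rw [UnitAddTorus.mFourier_add]; ring
  rw [mFourierCoeff_eq]
  simp only [h1]
  rw [integral_finsetSum _ fun n _ => integrable_mFourier_mul_primeArcs Q _]
  simp only [integral_mFourier_mul_snd]
  have h2 : ∀ n ∈ symmIcc N, (if (cubicFreq n + -m) 0 = 0 then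
      fourierCoeff (primeArcs Q) (-(cubicFreq n + -m) 1) else 0) =
      if m 0 = n then fourierCoeff (primeArcs Q) (m 1 - m 0 ^ 3) else 0 := by
    intro n _
    have e0 : (cubicFreq n + -m) 0 = n - m 0 := by simp [cubicFreq, sub_eq_add_neg]
    have e1 : (cubicFreq n + -m) 1 = n ^ 3 - m 1 := by simp [cubicFreq, sub_eq_add_neg]
    simp only [e0, e1]
    by_cases h : m 0 = n
    · rw [if_pos h, if_pos (by omega), h]; congr 1; ring
    · rw [if_neg h, if_neg (by omega)]
  rw [Finset.sum_congr rfl h2, Finset.sum_ite_eq]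

theorem exists_norm_arcKernel_le (ε : ℝ) (hε : 0 < ε) :
    ∃ C : ℝ, 1 ≤ C ∧ ∀ N : ℕ, 1 ≤ N → ∀ Q : ℕ, 24 * N ^ 2 ≤ Q → ∀ z,
      ‖arcKernel N Q z‖ ≤ C * (Q : ℝ) ^ ε * ((N : ℝ) * Q) ^ (1 / 4 : ℝ) := by
  obtain ⟨C, hC1, hC⟩ := exists_weyl_bound (4 * ε) (by positivity)
  have h4 : (1 : ℝ) ≤ 4 ^ (1 + 4 * ε) := Real.one_le_rpow (by norm_num) (by positivity)
  refine ⟨C * 4 ^ (1 + 4 * ε), by nlinarith, fun N hN Q hQ z => ?_⟩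
  have hQ0 : 1 ≤ Q := by nlinarith
  have hQR : (1 : ℝ) ≤ Q := by exact_mod_cast hQ0
  have hNR : (1 : ℝ) ≤ N := by exact_mod_cast hN
  by_cases h : primeArcs Q (z 1) = 0
  · rw [arcKernel, h, mul_zero, norm_zero]; positivity
  obtain ⟨q, hq, u, hu, hd⟩ := exists_near_of_primeArcs_ne_zero h
  obtain ⟨⟨hq1, hq2⟩, hqp⟩ := mem_primesBetween.mp hq
  have hq2' : (q : ℝ) ≤ 4 * Q := by exact_mod_cast hq2
  have hq0 : (0 : ℝ) < q := by exact_mod_cast hqp.pos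
  -- The radius 1/(64Q²) equals 1/(4(4Q)²), so q ≤ 4Q puts t in the range of Weyl's inequality for
  -- every admissible q.
  have hd' : ‖z 1 - u‖ ≤ 1 / (4 * (q : ℝ) ^ 2) := by
    refine hd.trans ?_
    unfold arcRadius
    apply one_div_le_one_div_of_le (by positivity)
    nlinarith
  have h1 := hC N hN q (by omega) (z 0) (z 1) u hu hd'
  have h2 : ‖arcKernel N Q z‖ ≤ ‖∑ n ∈ symmIcc N, expChar (cubicPhase (z 0) (z 1) n)‖ := by
    rw [arcKernel, norm_mul]
    simp only [mFourier_cubicFreq]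
    exact mul_le_of_le_one_right (norm_nonneg _) (norm_primeArcs_le _ _)
  refine h2.trans (le_of_pow_le_pow_left₀ (n := 4) (by norm_num) (by positivity) (h1.trans ?_))
  have e1 : ((Q : ℝ) ^ ε) ^ 4 = (Q : ℝ) ^ (4 * ε) := by
    rw [← Real.rpow_natCast, ← Real.rpow_mul (by positivity)]; congr 1; push_cast; ring
  have e2 : (((N : ℝ) * Q) ^ (1 / 4 : ℝ)) ^ 4 = N * Q := by
    rw [← Real.rpow_natCast, ← Real.rpow_mul (by positivity)]; norm_num
  rw [mul_pow, mul_pow, e1, e2]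
  have e3 : (q : ℝ) ^ (1 + 4 * ε) ≤ 4 ^ (1 + 4 * ε) * (Q * (Q : ℝ) ^ (4 * ε)) := by
    calc _ ≤ (4 * (Q : ℝ)) ^ (1 + 4 * ε) := by gcongr
      _ = _ := by
        rw [Real.mul_rpow (by norm_num) (by positivity),
          Real.rpow_add (show (0 : ℝ) < Q by positivity) 1, Real.rpow_one]
  set y := (4 : ℝ) ^ (1 + 4 * ε)
  have e4 : C * y ≤ (C * y) ^ 4 := le_self_pow₀ (by nlinarith) (by norm_num)
  have hY : 0 ≤ (Q : ℝ) ^ (4 * ε) := by positivity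
  calc C * N * (q : ℝ) ^ (1 + 4 * ε) ≤ C * N * (y * (Q * (Q : ℝ) ^ (4 * ε))) := by gcongr
    _ = (C * y) * (Q : ℝ) ^ (4 * ε) * (N * Q) := by ring
    _ ≤ _ := by gcongr

/-- The localised restriction inequality obtained from the kernel decomposition at height `Q`. -/
theorem exists_restriction_bound (ε : ℝ) (hε : 0 < ε) :
    ∃ C : ℝ, 1 ≤ C ∧ ∃ Q₀ : ℕ, ∀ N : ℕ, 1 ≤ N → ∀ Q : ℕ, Q₀ ≤ Q → 24 * N ^ 2 ≤ Q →
      ∀ f : Torus2 → ℂ, Measurable f → ∀ B : ℝ, (∀ z, ‖f z‖ ≤ B) →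
      ∑ n ∈ symmIcc N, ‖UnitAddTorus.mFourierCoeff f (cubicFreq n)‖ ^ 2 ≤
        C * (Q : ℝ) ^ ε * (((N : ℝ) * Q) ^ (1 / 4 : ℝ) * (∫ w, ‖f w‖ ∂torusMeasure) ^ 2 +
          (Q : ℝ)⁻¹ * ∫ w, ‖f w‖ ^ 2 ∂torusMeasure) := by
  obtain ⟨C, hC1, hC⟩ := exists_norm_arcKernel_le (ε / 2) (by positivity)
  obtain ⟨Q₀, hQ₀, hprime⟩ := exists_le_card_primesBetween
  set y := (4 : ℝ) ^ (ε / 2) with hy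
  have hy1 : (1 : ℝ) ≤ y := Real.one_le_rpow (by norm_num) (by positivity)
  refine ⟨1 + 32 * (2 / ε * y) * (C + 15), ?_, Q₀, fun N hN Q hQ hNQ f hf B hB => ?_⟩
  · have : 0 ≤ 32 * (2 / ε * y) * (C + 15) := by positivity
    linarith
  have hQ1 : 1 ≤ Q := hQ₀.trans hQ
  have hQR : (1 : ℝ) ≤ Q := by exact_mod_cast hQ1
  have hS : ∑ m ∈ (symmIcc N).image cubicFreq, ‖UnitAddTorus.mFourierCoeff f m‖ ^ 2 =
      ∑ n ∈ symmIcc N, ‖UnitAddTorus.mFourierCoeff f (cubicFreq n)‖ ^ 2 :=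
    Finset.sum_image fun a _ b _ h => cubicFreq_injective h
  have hmean := le_primeArcsMean hQ1
  have hmean0 : 0 ≤ primeArcsMean Q := le_trans (by positivity) hmean
  have hmem : ∀ m : Fin 2 → ℤ, m ∈ (symmIcc N).image cubicFreq ↔
      m 0 ∈ symmIcc N ∧ m 1 = m 0 ^ 3 := by
    intro m
    rw [Finset.mem_image]
    constructor
    · rintro ⟨n, hn, rfl⟩
      exact ⟨by simpa [cubicFreq] using hn, by simp [cubicFreq]⟩
    · rintro ⟨h0, h1⟩
      refine ⟨m 0, h0, funext fun i => ?_⟩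
      fin_cases i
      · rfl
      · simp [cubicFreq, h1]
  have key := sum_norm_sq_mFourierCoeff_le (measurable_arcKernel N Q) hf (hC N hN Q hNQ) hB
    ((symmIcc N).image cubicFreq) (c₀ := primeArcsMean Q) (δ := 15 / Q) hmean0 (by positivity)
    (fun m hm => by
      rw [hmem] at hm
      rw [mFourierCoeff_arcKernel, if_pos hm.1, hm.2, sub_self, fourierCoeff_primeArcs_zero hQ1])
    (fun m hm => by
      rw [hmem] at hm
      rw [mFourierCoeff_arcKernel]
      split_ifs with h
      · refine norm_fourierCoeff_primeArcs_le hQ1 fun h0 => hm ⟨h, by linarith⟩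
      · rw [norm_zero]; positivity)
  rw [hS] at key
  set S := ∑ n ∈ symmIcc N, ‖UnitAddTorus.mFourierCoeff f (cubicFreq n)‖ ^ 2
  set I1 := ∫ w, ‖f w‖ ∂torusMeasure
  set I2 := ∫ w, ‖f w‖ ^ 2 ∂torusMeasure
  set R := ((N : ℝ) * Q) ^ (1 / 4 : ℝ)
  set Y := (Q : ℝ) ^ (ε / 2) with hY
  have hY1 : 1 ≤ Y := Real.one_le_rpow hQR (by positivity)
  have hS0 : 0 ≤ S := Finset.sum_nonneg fun _ _ => by positivity
  have hI2 : 0 ≤ I2 := integral_nonneg fun _ => by positivity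
  have hR0 : 0 ≤ R := by positivity
  have hlog : Real.log (4 * Q) ≤ 2 / ε * y * Y := by
    have := Real.log_le_rpow_div (x := 4 * Q) (by positivity) (half_pos hε)
    rw [Real.mul_rpow (by norm_num) (by positivity)] at this
    calc _ ≤ _ := this
      _ = _ := by rw [← hy, ← hY]; field_simp
  have hP := hprime Q hQ
  have hlog0 : 0 ≤ Real.log (4 * Q) := Real.log_nonneg (by linarith)
  -- Chebyshev's bound makes the mean at least 1/(32 log 4Q). Dividing by it costs a logarithm, paid
  -- for by one of the two factors Q^(ε/2).
  have h1 : 1 ≤ 32 * Real.log (4 * Q) * primeArcsMean Q := by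
    calc (1 : ℝ) = Q / Q := by field_simp
      _ ≤ ((primesBetween Q).card * Real.log (4 * Q)) / Q := by gcongr
      _ = 32 * Real.log (4 * Q) * (((primesBetween Q).card : ℝ) / (32 * Q)) := by field_simp
      _ ≤ _ := by gcongr
  have hYY : (Q : ℝ) ^ ε = Y * Y := by
    rw [hY, ← Real.rpow_add (by positivity)]; congr 1; ring
  have h2 : 0 ≤ R * I1 ^ 2 + (Q : ℝ)⁻¹ * I2 := by positivity
  calc S ≤ (32 * Real.log (4 * Q) * primeArcsMean Q) * S := le_mul_of_one_le_left hS0 h1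
    _ = 32 * Real.log (4 * Q) * (primeArcsMean Q * S) := by ring
    _ ≤ 32 * (2 / ε * y * Y) * (C * Y * R * I1 ^ 2 + 15 / Q * I2) := by gcongr
    _ ≤ 32 * (2 / ε * y * Y) * ((C + 15) * Y * (R * I1 ^ 2 + (Q : ℝ)⁻¹ * I2)) := by
        gcongr
        have a1 : 0 ≤ Y * (R * I1 ^ 2) := by positivity
        have a2 : 0 ≤ (Q : ℝ)⁻¹ * I2 := by positivity
        have a3 : 15 / (Q : ℝ) * I2 = 15 * ((Q : ℝ)⁻¹ * I2) := by ring
        rw [a3]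
        have a4 : (Q : ℝ)⁻¹ * I2 ≤ Y * ((Q : ℝ)⁻¹ * I2) := le_mul_of_one_le_left a2 hY1
        have a5 : 0 ≤ C * (Y * ((Q : ℝ)⁻¹ * I2)) := by positivity
        nlinarith
    _ = (32 * (2 / ε * y) * (C + 15)) * (Y * Y) * (R * I1 ^ 2 + (Q : ℝ)⁻¹ * I2) := by ring
    _ ≤ _ := by
        rw [hYY]
        gcongr
        linarith

/-! ### The sixth moment and the level sets of an exponential sum. -/

theorem continuous_cubicSum (N : ℕ) (a : ℤ → ℂ) : Continuous (cubicSum N a) := by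
  unfold cubicSum
  fun_prop

theorem norm_cubicSum_le {N : ℕ} (hN : 1 ≤ N) {a : ℤ → ℂ} (hs : ∑ n ∈ symmIcc N, ‖a n‖ ^ 2 ≤ 1)
    (z : Torus2) : ‖cubicSum N a z‖ ≤ 2 * √N := by
  have h1 : ‖cubicSum N a z‖ ≤ ∑ n ∈ symmIcc N, ‖a n‖ := by
    refine (norm_sum_le _ _).trans (le_of_eq ?_)
    exact Finset.sum_congr rfl fun n _ => by rw [norm_mul, norm_mFourier_apply, mul_one]
  have h2 := sq_sum_le_card_mul_sum_sq (s := symmIcc N) (f := fun n => ‖a n‖)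
  have h3 : ((symmIcc N).card : ℝ) ≤ 4 * N := by
    rw [Int.card_Icc]
    have : ((N : ℤ) + 1 - -(N : ℤ)).toNat ≤ 4 * N := by omega
    exact_mod_cast this
  have h4 : (∑ n ∈ symmIcc N, ‖a n‖) ^ 2 ≤ 4 * N := by
    have : 0 ≤ ∑ n ∈ symmIcc N, ‖a n‖ ^ 2 := Finset.sum_nonneg fun _ _ => by positivity
    nlinarith
  refine h1.trans (le_of_sq_le_sq ?_ (by positivity))
  rw [mul_pow, Real.sq_sqrt (by positivity)]
  linarith

/-- Bourgain's `L⁶` estimate. -/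
theorem exists_integral_norm_cubicSum_pow_six_le (ε : ℝ) (hε : 0 < ε) :
    ∃ C : ℝ, 1 ≤ C ∧ ∀ N : ℕ, 1 ≤ N → ∀ a : ℤ → ℂ, ∑ n ∈ symmIcc N, ‖a n‖ ^ 2 ≤ 1 →
      ∫ z, ‖cubicSum N a z‖ ^ 6 ∂torusMeasure ≤ C * (N : ℝ) ^ ε := by
  obtain ⟨C, hC1, hC⟩ := exists_sum_triples_le ε hε
  refine ⟨C, hC1, fun N hN a hs => ?_⟩
  let v : ℤ × ℤ × ℤ → Fin 2 → ℤ := fun i => cubicFreq i.1 + cubicFreq i.2.1 + cubicFreq i.2.2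
  have h1 : ∀ z, ‖cubicSum N a z‖ ^ 6 = ‖∑ i ∈ triples N, (a i.1 * a i.2.1 * a i.2.2) *
      UnitAddTorus.mFourier (v i) z‖ ^ 2 := by
    intro z
    have : cubicSum N a z ^ 3 = ∑ i ∈ triples N, (a i.1 * a i.2.1 * a i.2.2) *
      UnitAddTorus.mFourier (v i) z := by
      rw [pow_succ, pow_two, cubicSum, mul_assoc, Finset.sum_mul_sum]
      simp only [triples, Finset.sum_product, Finset.sum_mul_sum]
      refine Finset.sum_congr rfl fun i _ => ?_
      simp only [Finset.mul_sum, v, UnitAddTorus.mFourier_add]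
      refine Finset.sum_congr rfl fun j _ => Finset.sum_congr rfl fun k _ => ?_
      ring
    rw [← this, norm_pow]; ring
  simp only [h1]
  refine (integral_norm_sq_sum_mFourier_le _ _ _).trans ?_
  have h2 := hC N hN (fun n => ‖a n‖) fun n => norm_nonneg _
  have hv : ∀ i j, v i = v j ↔ tripleSum i = tripleSum j ∧ tripleCubes i = tripleCubes j := by
    intro i j
    simp [v, funext_iff, Fin.forall_fin_two, cubicFreq, tripleSum, tripleCubes]
  simp only [norm_mul, hv]
  refine h2.trans ?_
  have h3 : (∑ n ∈ symmIcc N, ‖a n‖ ^ 2) ^ 3 ≤ 1 :=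
    pow_le_one₀ (Finset.sum_nonneg fun _ _ => by positivity) hs
  have : 0 ≤ C * (N : ℝ) ^ ε := by positivity
  nlinarith

theorem integral_conj_mul_cubicSum {f : Torus2 → ℂ} (hf : Integrable f torusMeasure) (N : ℕ)
    (a : ℤ → ℂ) : ∫ z, starRingEnd ℂ (f z) * cubicSum N a z ∂torusMeasure =
      ∑ n ∈ symmIcc N, a n * starRingEnd ℂ (UnitAddTorus.mFourierCoeff f (cubicFreq n)) := by
  have hint : ∀ n : ℤ, Integrable (fun z => a n * starRingEnd ℂ
      (UnitAddTorus.mFourier (-cubicFreq n) z * f z)) torusMeasure := by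
    intro n
    refine Integrable.const_mul ?_ _
    have h1 : Integrable (fun z => UnitAddTorus.mFourier (-cubicFreq n) z * f z) torusMeasure := by
      refine hf.bdd_mul (c := 1) (UnitAddTorus.mFourier _).continuous.aestronglyMeasurable
        (.of_forall fun z => (norm_mFourier_apply _ z).le)
    exact (LinearIsometryEquiv.integrable_comp_iff (Complex.conjLIE)).mpr h1
  have h1 : ∀ z, starRingEnd ℂ (f z) * cubicSum N a z = ∑ n ∈ symmIcc N,
      a n * starRingEnd ℂ (UnitAddTorus.mFourier (-cubicFreq n) z * f z) := by
    intro z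
    rw [cubicSum, Finset.mul_sum]
    refine Finset.sum_congr rfl fun n _ => ?_
    rw [map_mul, ← UnitAddTorus.mFourier_neg, neg_neg]; ring
  simp only [h1]
  rw [integral_finsetSum _ fun n _ => hint n]
  refine Finset.sum_congr rfl fun n _ => ?_
  rw [integral_const_mul, mFourierCoeff_eq, integral_conj]

/-- The measure of the level set `{|F| > r}` of an exponential sum. -/
def levelMeasure (N : ℕ) (a : ℤ → ℂ) (r : ℝ) : ℝ :=
  torusMeasure.real {z | r < ‖cubicSum N a z‖}

theorem measurableSet_level (N : ℕ) (a : ℤ → ℂ) (r : ℝ) :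
    MeasurableSet {z | r < ‖cubicSum N a z‖} :=
  (isOpen_lt continuous_const (continuous_cubicSum N a).norm).measurableSet

/-- Test the restriction inequality on f = F/|F| on the level set and 0 elsewhere. Both ‖f‖₁ and
‖f‖₂² equal the measure g of that set, the pairing of f with F is at least r·g, and Cauchy–Schwarz
against the coefficients bounds its square by the restriction sum. -/
theorem exists_levelMeasure_sq_le (ε : ℝ) (hε : 0 < ε) :
    ∃ C : ℝ, 1 ≤ C ∧ ∃ Q₀ : ℕ, ∀ N : ℕ, 1 ≤ N → ∀ Q : ℕ, Q₀ ≤ Q → 24 * N ^ 2 ≤ Q →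
      ∀ a : ℤ → ℂ, ∑ n ∈ symmIcc N, ‖a n‖ ^ 2 ≤ 1 → ∀ r : ℝ, 0 < r →
      r ^ 2 * levelMeasure N a r ^ 2 ≤
        C * (Q : ℝ) ^ ε * (((N : ℝ) * Q) ^ (1 / 4 : ℝ) * levelMeasure N a r ^ 2 +
          (Q : ℝ)⁻¹ * levelMeasure N a r) := by
  obtain ⟨C, hC1, Q₀, hC⟩ := exists_restriction_bound ε hε
  refine ⟨C, hC1, Q₀, fun N hN Q hQ hNQ a hs r hr => ?_⟩
  set F := cubicSum N a with hF
  have hFm : Measurable F := (continuous_cubicSum N a).measurable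
  set G := {z | r < ‖F z‖} with hG
  have hGm : MeasurableSet G := measurableSet_level N a r
  set g := levelMeasure N a r with hg
  have hg0 : 0 ≤ g := measureReal_nonneg
  set f : Torus2 → ℂ := G.indicator fun z => F z / (‖F z‖ : ℝ) with hf
  have hfm : Measurable f := (hFm.div (Complex.measurable_ofReal.comp hFm.norm)).indicator hGm
  have hfn : ∀ z, ‖f z‖ = G.indicator (fun _ => (1 : ℝ)) z := by
    intro z
    by_cases hz : z ∈ G
    · have : 0 < ‖F z‖ := hr.trans hz
      rw [hf, Set.indicator_of_mem hz, Set.indicator_of_mem hz, norm_div, Complex.norm_real,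
        norm_norm, div_self this.ne']
    · rw [hf, Set.indicator_of_notMem hz, Set.indicator_of_notMem hz, norm_zero]
  have hf1 : ∀ z, ‖f z‖ ≤ 1 := fun z => by
    rw [hfn]; exact Set.indicator_le_self' (fun _ _ => zero_le_one) z
  have hI1 : ∫ z, ‖f z‖ ∂torusMeasure = g := by
    simp only [hfn]
    rw [integral_indicator_const _ hGm]; simp [hg, levelMeasure, hG, hF]
  have hI2 : ∫ z, ‖f z‖ ^ 2 ∂torusMeasure = g := by
    rw [← hI1]
    refine integral_congr_ae (.of_forall fun z => ?_)
    simp only [hfn]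
    by_cases hz : z ∈ G <;> simp [hz]
  have hmain := hC N hN Q hQ hNQ f hfm 1 hf1
  rw [hI1, hI2] at hmain
  refine le_trans ?_ hmain
  have hfint := integrable_of_bounded hfm hf1
  have hpair := integral_conj_mul_cubicSum hfint N a
  have hlow : r * g ≤ ‖∫ z, starRingEnd ℂ (f z) * cubicSum N a z ∂torusMeasure‖ := by
    have e1 : ∀ z, starRingEnd ℂ (f z) * cubicSum N a z =
        ((G.indicator (fun z => ‖F z‖) z : ℝ) : ℂ) := by
      intro z
      by_cases hz : z ∈ G
      · have : ((‖F z‖ : ℝ) : ℂ) ≠ 0 := Complex.ofReal_ne_zero.mpr (hr.trans hz).ne'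
        rw [hf, Set.indicator_of_mem hz, Set.indicator_of_mem hz, map_div₀, Complex.conj_ofReal,
          div_mul_eq_mul_div, Complex.conj_mul', div_eq_iff this]
        ring
      · rw [hf, Set.indicator_of_notMem hz, Set.indicator_of_notMem hz]; simp
    simp only [e1]
    rw [integral_complex_ofReal, Complex.norm_real]
    refine le_trans ?_ (le_abs_self _)
    rw [← hI1, ← integral_const_mul]
    refine integral_mono (hfint.norm.const_mul r) ?_ fun z => ?_
    · exact (((continuous_cubicSum N a).integrable_of_hasCompactSupport
        (HasCompactSupport.of_compactSpace _)).norm).indicator hGm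
    · simp only [hfn]
      by_cases hz : z ∈ G
      · rw [Set.indicator_of_mem hz, Set.indicator_of_mem hz, mul_one]; exact le_of_lt hz
      · rw [Set.indicator_of_notMem hz, Set.indicator_of_notMem hz, mul_zero]
  rw [hpair] at hlow
  set S := ∑ n ∈ symmIcc N, ‖UnitAddTorus.mFourierCoeff f (cubicFreq n)‖ ^ 2
  have hS0 : 0 ≤ S := Finset.sum_nonneg fun _ _ => by positivity
  have hcs : ‖∑ n ∈ symmIcc N, a n * starRingEnd ℂ (UnitAddTorus.mFourierCoeff f (cubicFreq n))‖ ^ 2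
      ≤ S := by
    have e1 : ‖∑ n ∈ symmIcc N, a n *
        starRingEnd ℂ (UnitAddTorus.mFourierCoeff f (cubicFreq n))‖ ≤
        ∑ n ∈ symmIcc N, ‖a n‖ * ‖UnitAddTorus.mFourierCoeff f (cubicFreq n)‖ := by
      refine (norm_sum_le _ _).trans (le_of_eq (Finset.sum_congr rfl fun n _ => ?_))
      rw [norm_mul, RCLike.norm_conj]
    have e2 := Finset.sum_mul_sq_le_sq_mul_sq (symmIcc N) (fun n => ‖a n‖)
      (fun n => ‖UnitAddTorus.mFourierCoeff f (cubicFreq n)‖)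
    calc _ ≤ _ := pow_le_pow_left₀ (norm_nonneg _) e1 2
      _ ≤ _ := e2
      _ ≤ 1 * S := mul_le_mul_of_nonneg_right hs hS0
      _ = S := one_mul _
  calc r ^ 2 * g ^ 2 = (r * g) ^ 2 := by ring
    _ ≤ _ := pow_le_pow_left₀ (by positivity) hlow 2
    _ ≤ S := hcs

/-- The level set estimate. -/
theorem exists_levelMeasure_le (η : ℝ) (hη : 0 < η) :
    ∃ B : ℝ, 1 ≤ B ∧ ∃ D : ℝ, 1 ≤ D ∧ ∀ N : ℕ, 1 ≤ N → ∀ a : ℤ → ℂ,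
      ∑ n ∈ symmIcc N, ‖a n‖ ^ 2 ≤ 1 → ∀ r : ℝ, B * ((N : ℝ) ^ (3 + 12 * η)) ^ (1 / 8 : ℝ) ≤ r →
      r ≤ 2 * √N → levelMeasure N a r * r ^ 10 ≤ D * (N : ℝ) ^ (1 + 15 * η) := by
  obtain ⟨C, hC1, Q₀, hC⟩ := exists_levelMeasure_sq_le η hη
  set y := (256 : ℝ) ^ η with hy
  have hy1 : 1 ≤ y := Real.one_le_rpow (by norm_num) hη.le
  set b := 2 * C * y with hb
  have hb1 : 1 ≤ b := by nlinarith
  have hb4 : 1 ≤ b ^ 4 := one_le_pow₀ hb1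
  set A := b ^ 4 * (25 + Q₀) with hA
  have hQ₀ : (0 : ℝ) ≤ Q₀ := by positivity
  have hA1 : 1 ≤ A := by nlinarith
  refine ⟨A ^ (1 / 8 : ℝ), Real.one_le_rpow hA1 (by norm_num), 4 * C * y * b ^ 4, ?_,
    fun N hN a hs r hr1 hr2 => ?_⟩
  · nlinarith [mul_nonneg (by linarith : 0 ≤ C) (by linarith : 0 ≤ y)]
  have hNR : (1 : ℝ) ≤ N := by exact_mod_cast hN
  have hN0 : (0 : ℝ) < N := by linarith
  set x := (N : ℝ) ^ η with hx
  have hx1 : 1 ≤ x := Real.one_le_rpow hNR hη.le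
  have hx0 : 0 < x := by linarith
  have hpow : ∀ k : ℕ, (N : ℝ) ^ ((k : ℝ) * η) = x ^ k := by
    intro k; rw [mul_comm, Real.rpow_mul hN0.le, Real.rpow_natCast]
  have hN12 : (N : ℝ) ^ (3 + 12 * η) = (N : ℝ) ^ 3 * x ^ 12 := by
    rw [Real.rpow_add hN0, ← hpow 12]; norm_cast
  have hN15 : (N : ℝ) ^ (1 + 15 * η) = N * x ^ 15 := by
    rw [Real.rpow_add hN0, ← hpow 15, Real.rpow_one]; norm_cast
  have hr0 : 0 < r := lt_of_lt_of_le (by positivity) hr1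
  have hr8 : A * ((N : ℝ) ^ 3 * x ^ 12) ≤ r ^ 8 := by
    rw [← Real.mul_rpow (by positivity) (by positivity)] at hr1
    have := pow_le_pow_left₀ (by positivity) hr1 8
    rw [← Real.rpow_natCast, ← Real.rpow_mul (by positivity)] at this
    norm_num at this
    rwa [← hN12]
  have hr8' : r ^ 8 ≤ 256 * (N : ℝ) ^ 4 := by
    calc r ^ 8 ≤ (2 * √N) ^ 8 := by gcongr
      _ = 256 * (√N ^ 2) ^ 4 := by ring
      _ = _ := by rw [Real.sq_sqrt hN0.le]
  -- Q is the integer part of X, chosen to make C Q^η (NQ)^(1/4) ≤ r²/2, so that the quadratic term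
  -- is absorbed on the left. The lower bound on r gives Q ≥ 24N² and Q ≥ Q₀. The upper bound r ≤
  -- 2√N gives Q ≤ 256N³, hence Q^η ≤ y x³; this explains the powers of x and the value of y.
  set X := r ^ 8 / (N * x ^ 12 * b ^ 4) with hX
  have hX1 : (25 + Q₀) * (N : ℝ) ^ 2 ≤ X := by
    rw [hX, le_div_iff₀ (by positivity)]
    calc _ = A * ((N : ℝ) ^ 3 * x ^ 12) := by rw [hA]; ring
      _ ≤ _ := hr8
  have hX2 : X ≤ 256 * (N : ℝ) ^ 3 := by
    rw [hX, div_le_iff₀ (by positivity)]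
    have h1 : 1 ≤ x ^ 12 * b ^ 4 := by
      have := one_le_pow₀ hx1 (n := 12); nlinarith
    calc r ^ 8 ≤ 256 * (N : ℝ) ^ 4 := hr8'
      _ ≤ 256 * (N : ℝ) ^ 4 * (x ^ 12 * b ^ 4) := le_mul_of_one_le_right (by positivity) h1
      _ = _ := by ring
  have hNsq : (1 : ℝ) ≤ (N : ℝ) ^ 2 := one_le_pow₀ hNR
  set Q := ⌊X⌋₊ with hQ
  have hX0 : 0 < X := by positivity
  have hQX : (Q : ℝ) ≤ X := Nat.floor_le hX0.le
  have hXQ : X < Q + 1 := Nat.lt_floor_add_one X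
  have hQ1 : Q₀ ≤ Q := Nat.le_floor (by nlinarith)
  have hQ2 : 24 * N ^ 2 ≤ Q := by
    refine Nat.le_floor ?_
    push_cast; nlinarith
  have hXQ2 : X ≤ 2 * Q := by nlinarith
  have hQ0 : (0 : ℝ) < Q := by nlinarith
  have hmain := hC N hN Q hQ1 hQ2 a hs r hr0
  set g := levelMeasure N a r
  have hg0 : 0 ≤ g := measureReal_nonneg
  have hQη : (Q : ℝ) ^ η ≤ y * x ^ 3 := by
    calc (Q : ℝ) ^ η ≤ (256 * (N : ℝ) ^ 3) ^ η := by gcongr; linarith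
      _ = y * x ^ 3 := by
        rw [Real.mul_rpow (by norm_num) (by positivity), ← Real.rpow_natCast,
          ← Real.rpow_mul hN0.le, ← hpow 3]
  have hR : ((N : ℝ) * Q) ^ (1 / 4 : ℝ) ≤ r ^ 2 / (x ^ 3 * b) := by
    have e1 : (N : ℝ) * Q ≤ (r ^ 2 / (x ^ 3 * b)) ^ 4 := by
      calc (N : ℝ) * Q ≤ N * X := by gcongr
        _ = _ := by rw [hX]; field_simp
    calc _ ≤ ((r ^ 2 / (x ^ 3 * b)) ^ 4) ^ (1 / 4 : ℝ) := by gcongr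
      _ = _ := by
        rw [← Real.rpow_natCast, ← Real.rpow_mul (by positivity)]; norm_num
  have h1 : C * (Q : ℝ) ^ η * ((N : ℝ) * Q) ^ (1 / 4 : ℝ) ≤ r ^ 2 / 2 := by
    calc _ ≤ C * (y * x ^ 3) * (r ^ 2 / (x ^ 3 * b)) := by gcongr
      _ = _ := by rw [hb]; field_simp
  have h2 : C * (Q : ℝ) ^ η * (Q : ℝ)⁻¹ ≤ C * (y * x ^ 3) * (2 / X) := by
    have : (Q : ℝ)⁻¹ ≤ 2 / X := by
      rw [le_div_iff₀ hX0, inv_mul_le_iff₀ hQ0]; linarith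
    gcongr
  have h3 : r ^ 2 * g ^ 2 ≤ r ^ 2 / 2 * g ^ 2 + C * (y * x ^ 3) * (2 / X) * g := by
    calc _ ≤ _ := hmain
      _ = (C * (Q : ℝ) ^ η * ((N : ℝ) * Q) ^ (1 / 4 : ℝ)) * g ^ 2 +
          (C * (Q : ℝ) ^ η * (Q : ℝ)⁻¹) * g := by ring
      _ ≤ _ := by gcongr
  have h4 : r ^ 2 / 2 * g ≤ C * (y * x ^ 3) * (2 / X) := by
    rcases hg0.eq_or_lt with h | h
    · rw [← h, mul_zero]; positivity
    · have : (r ^ 2 / 2 * g) * g ≤ C * (y * x ^ 3) * (2 / X) * g := by linarith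
      exact le_of_mul_le_mul_right this h
  rw [hN15]
  have h5 : C * (y * x ^ 3) * (2 / X) * (2 * r ^ 8) = 4 * C * y * b ^ 4 * (N * x ^ 15) := by
    rw [hX]; field_simp; ring
  calc g * r ^ 10 = (r ^ 2 / 2 * g) * (2 * r ^ 8) := by ring
    _ ≤ C * (y * x ^ 3) * (2 / X) * (2 * r ^ 8) := by gcongr
    _ = _ := h5

/-! ### The fourteenth moment. -/

theorem integrable_of_continuous {f : Torus2 → ℝ} (hf : Continuous f) :
    Integrable f torusMeasure :=
  hf.integrable_of_hasCompactSupport (HasCompactSupport.of_compactSpace _)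

/-- The contribution of the set `{|F| ≤ r}` to `∫ |F|¹⁴`. -/
def truncatedMoment (N : ℕ) (a : ℤ → ℂ) (r : ℝ) : ℝ :=
  ∫ z, {z | r < ‖cubicSum N a z‖}ᶜ.indicator (fun z => ‖cubicSum N a z‖ ^ 14) z ∂torusMeasure

theorem integrable_truncated (N : ℕ) (a : ℤ → ℂ) (r : ℝ) :
    Integrable ({z | r < ‖cubicSum N a z‖}ᶜ.indicator fun z => ‖cubicSum N a z‖ ^ 14)
      torusMeasure :=
  (integrable_of_continuous ((continuous_cubicSum N a).norm.pow 14)).indicator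
    (measurableSet_level N a r).compl

theorem truncatedMoment_two_mul_le (N : ℕ) (a : ℤ → ℂ) {r : ℝ} (hr : 0 ≤ r) :
    truncatedMoment N a (2 * r) ≤ truncatedMoment N a r + (2 * r) ^ 14 * levelMeasure N a r := by
  have h1 : (2 * r) ^ 14 * levelMeasure N a r =
      ∫ z, {z | r < ‖cubicSum N a z‖}.indicator (fun _ => (2 * r) ^ 14) z ∂torusMeasure := by
    rw [integral_indicator_const _ (measurableSet_level N a r), smul_eq_mul, mul_comm]; rfl
  have h2 : Integrable ({z | r < ‖cubicSum N a z‖}.indicator fun _ => (2 * r) ^ 14)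
      torusMeasure := (integrable_const _).indicator (measurableSet_level N a r)
  rw [h1, truncatedMoment, truncatedMoment, ← integral_add (integrable_truncated N a r) h2]
  refine integral_mono (integrable_truncated N a _) ((integrable_truncated N a r).add h2) fun z => ?_
  have hz0 := norm_nonneg (cubicSum N a z)
  simp only [Set.indicator, Set.mem_compl_iff, Set.mem_ofPred_eq]
  by_cases h : r < ‖cubicSum N a z‖
  · by_cases h' : 2 * r < ‖cubicSum N a z‖
    · simp only [h, h', not_true_eq_false, if_true, if_false]; positivity
    · simp only [h, h', not_true_eq_false, not_false_eq_true, if_true, if_false, zero_add]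
      exact pow_le_pow_left₀ hz0 (not_lt.mp h') 14
  · have h' : ¬ 2 * r < ‖cubicSum N a z‖ := by linarith
    simp only [h, h', not_false_eq_true, if_true, if_false, add_zero]; rfl

theorem truncatedMoment_le (N : ℕ) (a : ℤ → ℂ) (r : ℝ) :
    truncatedMoment N a r ≤ r ^ 8 * ∫ z, ‖cubicSum N a z‖ ^ 6 ∂torusMeasure := by
  rw [← integral_const_mul]
  refine integral_mono (integrable_truncated N a r)
    ((integrable_of_continuous ((continuous_cubicSum N a).norm.pow 6)).const_mul _) fun z => ?_
  have hz0 := norm_nonneg (cubicSum N a z)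
  simp only [Set.indicator, Set.mem_compl_iff, Set.mem_ofPred_eq]
  split_ifs with h
  · have : 0 ≤ r ^ 8 := by positivity
    positivity
  · have : ‖cubicSum N a z‖ ^ 8 ≤ r ^ 8 := pow_le_pow_left₀ hz0 (not_lt.mp h) 8
    calc ‖cubicSum N a z‖ ^ 14 = ‖cubicSum N a z‖ ^ 8 * ‖cubicSum N a z‖ ^ 6 := by ring
      _ ≤ _ := by gcongr

theorem truncatedMoment_eq {N : ℕ} {a : ℤ → ℂ} {r : ℝ} (h : ∀ z, ‖cubicSum N a z‖ ≤ r) :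
    truncatedMoment N a r = ∫ z, ‖cubicSum N a z‖ ^ 14 ∂torusMeasure := by
  refine integral_congr_ae (.of_forall fun z => ?_)
  exact Set.indicator_of_mem (not_lt.mpr (h z)) _

/-- The critical `L¹⁴` estimate. -/
theorem exists_integral_norm_cubicSum_pow_fourteen_le (ε : ℝ) (hε : 0 < ε) :
    ∃ C : ℝ, 1 ≤ C ∧ ∀ N : ℕ, 1 ≤ N → ∀ a : ℤ → ℂ, ∑ n ∈ symmIcc N, ‖a n‖ ^ 2 ≤ 1 →
      ∫ z, ‖cubicSum N a z‖ ^ 14 ∂torusMeasure ≤ C * (N : ℝ) ^ (3 + ε) := by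
  set η := ε / 15 with hη
  have hη0 : 0 < η := by positivity
  obtain ⟨B, hB1, D, hD1, hlev⟩ := exists_levelMeasure_le η hη0
  obtain ⟨C, hC1, hsix⟩ := exists_integral_norm_cubicSum_pow_six_le η hη0
  refine ⟨B ^ 8 * C + 2 ^ 14 * D * 256, ?_, fun N hN a hs => ?_⟩
  · have : 0 ≤ B ^ 8 * C := by positivity
    linarith
  have hNR : (1 : ℝ) ≤ N := by exact_mod_cast hN
  have hN0 : (0 : ℝ) < N := by linarith
  set r₀ := B * ((N : ℝ) ^ (3 + 12 * η)) ^ (1 / 8 : ℝ) with hr₀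
  have hr₀0 : 0 < r₀ := by positivity
  have hr₀8 : r₀ ^ 8 = B ^ 8 * (N : ℝ) ^ (3 + 12 * η) := by
    rw [hr₀, mul_pow, ← Real.rpow_natCast (((N : ℝ) ^ (3 + 12 * η)) ^ (1 / 8 : ℝ)),
      ← Real.rpow_mul (by positivity)]
    norm_num
  set E := 2 ^ 14 * D * (N : ℝ) ^ (1 + 15 * η) with hE
  have hE0 : 0 ≤ E := by positivity
  -- Doubling r adds at most E r⁴, and 2E r⁴ ≤ E(2r)⁴, so the increments sum geometrically without a
  -- logarithm. The limit 4√N keeps the radius before the last doubling within the range r ≤ 2√N of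
  -- the level set estimate.
  have hind : ∀ j : ℕ, 2 ^ j * r₀ ≤ 4 * √N →
      truncatedMoment N a (2 ^ j * r₀) ≤ truncatedMoment N a r₀ + E * (2 ^ j * r₀) ^ 4 := by
    intro j
    induction j with
    | zero =>
      intro _
      simp only [pow_zero, one_mul]
      have : 0 ≤ E * r₀ ^ 4 := by positivity
      linarith
    | succ j ih =>
      intro hj
      set r := 2 ^ j * r₀ with hr
      have hr' : 2 ^ (j + 1) * r₀ = 2 * r := by rw [hr, pow_succ]; ring
      rw [hr'] at hj ⊢
      have hr0 : 0 < r := by positivity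
      have hrr : r₀ ≤ r := le_mul_of_one_le_left hr₀0.le (one_le_pow₀ (by norm_num))
      have h1 := ih (by linarith)
      have h2 := truncatedMoment_two_mul_le N a hr0.le
      have h3 := hlev N hN a hs r hrr (by linarith)
      have h4 : (2 * r) ^ 14 * levelMeasure N a r ≤ E * r ^ 4 := by
        calc _ = 2 ^ 14 * r ^ 4 * (levelMeasure N a r * r ^ 10) := by ring
          _ ≤ 2 ^ 14 * r ^ 4 * (D * (N : ℝ) ^ (1 + 15 * η)) := by gcongr
          _ = _ := by rw [hE]; ring
      have h5 : 0 ≤ E * r ^ 4 := by positivity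
      have h6 : E * (2 * r) ^ 4 = 16 * (E * r ^ 4) := by ring
      linarith
  have hbase : truncatedMoment N a r₀ ≤ B ^ 8 * C * (N : ℝ) ^ (3 + ε) := by
    refine (truncatedMoment_le N a r₀).trans ?_
    calc _ ≤ r₀ ^ 8 * (C * (N : ℝ) ^ η) := by gcongr; exact hsix N hN a hs
      _ = B ^ 8 * C * ((N : ℝ) ^ (3 + 12 * η) * (N : ℝ) ^ η) := by rw [hr₀8]; ring
      _ ≤ _ := by
        gcongr
        rw [← Real.rpow_add hN0]
        exact Real.rpow_le_rpow_of_exponent_le hNR (by linarith)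
  have hsup := norm_cubicSum_le hN hs
  have hend : E * (4 * √N) ^ 4 = 2 ^ 14 * D * 256 * (N : ℝ) ^ (3 + ε) := by
    have e1 : (4 * √(N : ℝ)) ^ 4 = 256 * (N : ℝ) ^ 2 := by
      calc _ = 256 * (√(N : ℝ) ^ 2) ^ 2 := by ring
        _ = _ := by rw [Real.sq_sqrt hN0.le]
    have e2 : (N : ℝ) ^ (3 + ε) = (N : ℝ) ^ (1 + 15 * η) * (N : ℝ) ^ 2 := by
      rw [← Real.rpow_natCast, ← Real.rpow_add hN0]; congr 1; push_cast; rw [hη]; ring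
    rw [e1, e2, hE]; ring
  have hex : ∃ j : ℕ, 2 * √N ≤ 2 ^ j * r₀ := by
    obtain ⟨j, hj⟩ := pow_unbounded_of_one_lt (2 * √N / r₀) (one_lt_two)
    exact ⟨j, by rw [div_lt_iff₀ hr₀0] at hj; exact hj.le⟩
  classical
  have hj := Nat.find_spec hex
  -- The first dyadic radius reaching the supremum bound 2√N: the truncation there is vacuous, and
  -- minimality keeps it at most 4√N unless j = 0.
  set j := Nat.find hex with hjdef
  rw [← truncatedMoment_eq fun z => (hsup z).trans hj, add_mul]
  rcases Nat.eq_zero_or_pos j with h0 | hpos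
  · rw [h0, pow_zero, one_mul]
    have : 0 ≤ 2 ^ 14 * D * 256 * (N : ℝ) ^ (3 + ε) := by positivity
    linarith
  · have hlt := Nat.find_min hex (m := j - 1) (by omega)
    have hj' : 2 ^ j * r₀ ≤ 4 * √N := by
      obtain ⟨i, hi⟩ : ∃ i, j = i + 1 := ⟨j - 1, by omega⟩
      rw [hi] at hlt ⊢
      simp only [Nat.add_sub_cancel, not_le] at hlt
      rw [pow_succ]; linarith
    have h1 := hind j hj'
    have h2 : E * (2 ^ j * r₀) ^ 4 ≤ E * (4 * √N) ^ 4 := by gcongr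
    linarith

/-! ### All exponents p ≥ 14, and duality. -/

theorem memLp_cubicSum (N : ℕ) (a : ℤ → ℂ) (p : ℝ≥0∞) : MemLp (cubicSum N a) p torusMeasure :=
  (continuous_cubicSum N a).memLp_of_hasCompactSupport (HasCompactSupport.of_compactSpace _)

/-- Interpolation with the supremum: |F|^p ≤ (2√N)^(p−14)|F|¹⁴, and (p − 14)/2 + 3 = p(1/2 − 4/p).
-/
theorem exists_eLpNorm_cubicSum_le_of_le_one {p : ℝ} (hp : 14 ≤ p) {ε : ℝ} (hε : 0 < ε) :
    ∃ C : ℝ, 0 < C ∧ ∀ N : ℕ, 1 ≤ N → ∀ a : ℤ → ℂ, ∑ n ∈ symmIcc N, ‖a n‖ ^ 2 ≤ 1 →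
      eLpNorm (cubicSum N a) (ENNReal.ofReal p) torusMeasure ≤
        ENNReal.ofReal (C * (N : ℝ) ^ (1 / 2 - 4 / p + ε)) := by
  have hp0 : 0 < p := by linarith
  obtain ⟨C, hC1, hC⟩ := exists_integral_norm_cubicSum_pow_fourteen_le (p * ε) (by positivity)
  refine ⟨(2 ^ (p - 14) * C) ^ p⁻¹, by positivity, fun N hN a hs => ?_⟩
  have hNR : (1 : ℝ) ≤ N := by exact_mod_cast hN
  have hN0 : (0 : ℝ) < N := by linarith
  rw [(memLp_cubicSum N a _).eLpNorm_eq_integral_rpow_norm (by simpa using hp0) ENNReal.ofReal_ne_top,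
    ENNReal.toReal_ofReal hp0.le]
  refine ENNReal.ofReal_le_ofReal ?_
  have h1 : ∫ z, ‖cubicSum N a z‖ ^ p ∂torusMeasure ≤
      (2 * √N) ^ (p - 14) * ∫ z, ‖cubicSum N a z‖ ^ 14 ∂torusMeasure := by
    rw [← integral_const_mul]
    refine integral_mono (integrable_of_continuous
      ((continuous_cubicSum N a).norm.rpow_const fun _ => Or.inr hp0.le))
      ((integrable_of_continuous ((continuous_cubicSum N a).norm.pow 14)).const_mul _) fun z => ?_
    have hz := norm_nonneg (cubicSum N a z)
    have e : ‖cubicSum N a z‖ ^ p = ‖cubicSum N a z‖ ^ (p - 14) * ‖cubicSum N a z‖ ^ 14 := by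
      rw [← Real.rpow_natCast _ 14, ← Real.rpow_add_of_nonneg hz (by linarith) (by norm_num)]
      congr 1; push_cast; ring
    simp only [e]
    gcongr
    exact norm_cubicSum_le hN hs z
  have h2 : (2 * √N) ^ (p - 14) * (C * (N : ℝ) ^ (3 + p * ε)) =
      (2 ^ (p - 14) * C) * (N : ℝ) ^ (p * (1 / 2 - 4 / p + ε)) := by
    rw [Real.mul_rpow (by norm_num) (by positivity), Real.sqrt_eq_rpow, ← Real.rpow_mul hN0.le]
    have : (N : ℝ) ^ (p * (1 / 2 - 4 / p + ε)) =
        (N : ℝ) ^ (1 / 2 * (p - 14)) * (N : ℝ) ^ (3 + p * ε) := by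
      rw [← Real.rpow_add hN0]; congr 1; field_simp; ring
    rw [this]; ring
  have h3 := h1.trans ((mul_le_mul_of_nonneg_left (hC N hN a hs) (by positivity)).trans h2.le)
  calc (∫ z, ‖cubicSum N a z‖ ^ p ∂torusMeasure) ^ p⁻¹
      ≤ ((2 ^ (p - 14) * C) * (N : ℝ) ^ (p * (1 / 2 - 4 / p + ε))) ^ p⁻¹ :=
        Real.rpow_le_rpow (integral_nonneg fun z => by positivity) h3 (by positivity)
    _ = _ := by
      rw [Real.mul_rpow (by positivity) (by positivity), ← Real.rpow_mul hN0.le]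
      congr 2; field_simp

theorem sum_enorm_sq_rpow_half (N : ℕ) (a : ℤ → ℂ) :
    (∑ n ∈ symmIcc N, ‖a n‖ₑ ^ 2) ^ (1 / 2 : ℝ) =
      ENNReal.ofReal (√(∑ n ∈ symmIcc N, ‖a n‖ ^ 2)) := by
  have : ∑ n ∈ symmIcc N, ‖a n‖ₑ ^ 2 = ENNReal.ofReal (∑ n ∈ symmIcc N, ‖a n‖ ^ 2) := by
    rw [ENNReal.ofReal_sum_of_nonneg fun _ _ => by positivity]
    refine Finset.sum_congr rfl fun n _ => ?_
    rw [ENNReal.ofReal_pow (norm_nonneg _), ofReal_norm]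
  rw [this, Real.sqrt_eq_rpow, ENNReal.ofReal_rpow_of_nonneg
    (Finset.sum_nonneg fun _ _ => by positivity) (by norm_num)]

theorem exists_eLpNorm_cubicSum_le {p : ℝ} (hp : 14 ≤ p) {ε : ℝ} (hε : 0 < ε) :
    ∃ C : ℝ, 0 < C ∧ ∀ N : ℕ, 1 ≤ N → ∀ a : ℤ → ℂ,
      eLpNorm (cubicSum N a) (ENNReal.ofReal p) torusMeasure ≤
        ENNReal.ofReal (C * (N : ℝ) ^ (1 / 2 - 4 / p + ε)) *
          (∑ n ∈ symmIcc N, ‖a n‖ₑ ^ 2) ^ (1 / 2 : ℝ) := by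
  obtain ⟨C, hC0, hC⟩ := exists_eLpNorm_cubicSum_le_of_le_one hp hε
  refine ⟨C, hC0, fun N hN a => ?_⟩
  rw [sum_enorm_sq_rpow_half]
  set s := ∑ n ∈ symmIcc N, ‖a n‖ ^ 2 with hs
  have hs0 : 0 ≤ s := Finset.sum_nonneg fun _ _ => by positivity
  rcases hs0.eq_or_lt with h0 | hpos
  · have hz : cubicSum N a = 0 := by
      funext z
      refine Finset.sum_eq_zero fun n hn => ?_
      have := (Finset.sum_eq_zero_iff_of_nonneg fun _ _ => by positivity).mp h0.symm n hn
      rw [norm_eq_zero.mp (pow_eq_zero_iff (two_ne_zero) |>.mp this), zero_mul]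
    rw [hz, eLpNorm_zero]; exact zero_le
  · have hsq : 0 < √s := Real.sqrt_pos.mpr hpos
    have hscale : cubicSum N a = ((√s : ℝ) : ℂ) • cubicSum N (fun n => a n / (√s : ℝ)) := by
      funext z
      simp only [cubicSum, Pi.smul_apply, smul_eq_mul, Finset.mul_sum]
      refine Finset.sum_congr rfl fun n _ => ?_
      have : ((√s : ℝ) : ℂ) ≠ 0 := Complex.ofReal_ne_zero.mpr hsq.ne'
      field_simp
    have hone : ∑ n ∈ symmIcc N, ‖a n / ((√s : ℝ) : ℂ)‖ ^ 2 ≤ 1 := by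
      simp only [norm_div, Complex.norm_real, Real.norm_of_nonneg hsq.le, div_pow, Real.sq_sqrt hs0]
      rw [← Finset.sum_div, ← hs, div_self hpos.ne']
    have h1 := hC N hN _ hone
    rw [hscale, eLpNorm_const_smul, mul_comm]
    refine mul_le_mul' h1 (le_of_eq ?_)
    rw [← ofReal_norm, Complex.norm_real, Real.norm_of_nonneg hsq.le]

/-- The duality between the restriction and the extension inequality. -/
theorem sum_enorm_mFourierCoeff_sq_le {p : ℝ} (hp : 1 < p) {N : ℕ} {K : ℝ≥0∞}
    (hK : ∀ a : ℤ → ℂ, eLpNorm (cubicSum N a) (ENNReal.ofReal p) torusMeasure ≤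
      K * (∑ n ∈ symmIcc N, ‖a n‖ₑ ^ 2) ^ (1 / 2 : ℝ)) {f : Torus2 → ℂ}
    (hf : MemLp f (ENNReal.ofReal (p / (p - 1))) torusMeasure) :
    ∑ n ∈ symmIcc N, ‖UnitAddTorus.mFourierCoeff f (cubicFreq n)‖ₑ ^ 2 ≤
      K ^ 2 * eLpNorm f (ENNReal.ofReal (p / (p - 1))) torusMeasure ^ 2 := by
  set p' := ENNReal.ofReal (p / (p - 1)) with hp'
  have hconj : p.HolderConjugate (p / (p - 1)) :=
    (Real.holderConjugate_iff_eq_conjExponent hp).mpr rfl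
  have hconj' : ENNReal.HolderConjugate p' (ENNReal.ofReal p) := hconj.symm.ennrealOfReal
  have hp1 : 1 ≤ p' := by
    rw [hp', ← ENNReal.ofReal_one]
    refine ENNReal.ofReal_le_ofReal ?_
    rw [le_div_iff₀ (by linarith)]; linarith
  have hfint : Integrable f torusMeasure := memLp_one_iff_integrable.mp (hf.mono_exponent hp1)
  -- With these coefficients the pairing of f with the exponential sum is exactly s; Hölder and `hK`
  -- give s ≤ K‖f‖√s, and √s cancels when it is nonzero.
  set a : ℤ → ℂ := fun n => UnitAddTorus.mFourierCoeff f (cubicFreq n) with ha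
  set s := ∑ n ∈ symmIcc N, ‖a n‖ ^ 2 with hs
  have hs0 : 0 ≤ s := Finset.sum_nonneg fun _ _ => by positivity
  have hsum : ∑ n ∈ symmIcc N, ‖a n‖ₑ ^ 2 = ENNReal.ofReal (√s) ^ 2 := by
    have h := sum_enorm_sq_rpow_half N a
    rw [← hs] at h
    rw [← h, ← ENNReal.rpow_natCast, ← ENNReal.rpow_mul]; norm_num
  have h1 : ∫ z, starRingEnd ℂ (f z) * cubicSum N a z ∂torusMeasure = (s : ℂ) := by
    rw [integral_conj_mul_cubicSum hfint, hs, Complex.ofReal_sum]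
    refine Finset.sum_congr rfl fun n _ => ?_
    rw [Complex.mul_conj']; push_cast; rfl
  have h2 : ENNReal.ofReal s ≤ eLpNorm f p' torusMeasure *
      eLpNorm (cubicSum N a) (ENNReal.ofReal p) torusMeasure := by
    have e1 : ENNReal.ofReal s =
        ‖∫ z, starRingEnd ℂ (f z) * cubicSum N a z ∂torusMeasure‖ₑ := by
      rw [h1, ← ofReal_norm, Complex.norm_real, Real.norm_of_nonneg hs0]
    have e2 : AEStronglyMeasurable (fun z => starRingEnd ℂ (f z)) torusMeasure :=
      Complex.continuous_conj.comp_aestronglyMeasurable hf.1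
    have e3 := eLpNorm_smul_le_mul_eLpNorm (p := p') (q := ENNReal.ofReal p) (r := 1)
      (memLp_cubicSum N a 1).1 e2
    have e4 : eLpNorm (fun z => starRingEnd ℂ (f z)) p' torusMeasure = eLpNorm f p' torusMeasure :=
      eLpNorm_congr_norm_ae (.of_forall fun z => RCLike.norm_conj _)
    rw [e1]
    refine (enorm_integral_le_lintegral_enorm _).trans ?_
    rw [eLpNorm_one_eq_lintegral_enorm, e4] at e3
    exact e3
  rw [hsum]
  have h3 := hK a
  rw [sum_enorm_sq_rpow_half, ← hs] at h3
  rcases (Real.sqrt_nonneg s).eq_or_lt with h0 | hpos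
  · rw [← h0]; simp
  have h4 : ENNReal.ofReal (√s) * ENNReal.ofReal (√s) ≤
      (K * eLpNorm f p' torusMeasure) * ENNReal.ofReal (√s) := by
    rw [← ENNReal.ofReal_mul (Real.sqrt_nonneg s), Real.mul_self_sqrt hs0]
    refine h2.trans ((mul_le_mul_right h3 _).trans (le_of_eq ?_))
    ring
  have h5 : ENNReal.ofReal (√s) ≤ K * eLpNorm f p' torusMeasure :=
    (ENNReal.mul_le_mul_iff_left (by simpa using hpos) ENNReal.ofReal_ne_top).mp h4
  rw [← mul_pow]
  exact pow_le_pow_left' h5 2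

end CubicRestriction

end

theorem theorem1 (p : ℝ) (hp : 14 ≤ p) (ε : ℝ) (hε : 0 < ε) :
    (∃ C : ℝ, 0 < C ∧ ∀ N : ℕ, 1 ≤ N →
      CubicRestriction.restrictionConst p N ≤
        ENNReal.ofReal (C * (N : ℝ) ^ (1 - 8 / p + ε))) ∧
    (∃ C : ℝ, 0 < C ∧ ∀ N : ℕ, 1 ≤ N →
      CubicRestriction.strichartzConst p N ≤
        ENNReal.ofReal (C * (N : ℝ) ^ (1 / 2 - 4 / p + ε))) := by
  constructor
  -- Duality squares the extension constant, hence ε/2 here and C² below.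
  · obtain ⟨C, hC0, hC⟩ := CubicRestriction.exists_eLpNorm_cubicSum_le hp (half_pos hε)
    refine ⟨C ^ 2, by positivity, fun N hN => sInf_le fun f hf => ?_⟩
    have h := CubicRestriction.sum_enorm_mFourierCoeff_sq_le (by linarith) (hC N hN) hf
    have hN0 : (0 : ℝ) < N := by exact_mod_cast hN
    rw [← ENNReal.ofReal_pow (by positivity), mul_pow, ← Real.rpow_natCast ((N : ℝ) ^ _),
      ← Real.rpow_mul hN0.le] at h
    have e : (1 / 2 - 4 / p + ε / 2) * ((2 : ℕ) : ℝ) = 1 - 8 / p + ε := by push_cast; ring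
    rwa [e] at h
  · obtain ⟨C, hC0, hC⟩ := CubicRestriction.exists_eLpNorm_cubicSum_le hp hε
    exact ⟨C, hC0, fun N hN => sInf_le fun a => hC N hN a⟩
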